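/- Let $L>0$, let $a,b,c>0$ be constants and let $p\in L^1[0,L]$ be nonnegative (almost everywhere). Consider the Melan problem $$w''''(x)-\Big(a+b\int_0^L w\,dt\Big)w''(x)+c\int_0^L w\,dt=p(x)\quad\text{for a.e. }x\in(0,L),\qquad w(0)=w(L)=w''(0)=w''(L)=0, \tag{P}$$ with solutions sought in $W^{4,1}[0,L]$. A function $\alpha\in W^{4,1}[0,L]$ with $\alpha(0)=\alpha(L)=\alpha''(0)=\alpha''(L)=0$ is a lower (upper) solution of (P) if the equation holds a.e. with $=$ replaced by $\le$ (by $\ge$). Put $$\sigma(z)=\frac{3z^3}{6z\cosh z+6z-12\sinh z-z^3}\qquad(z>0).$$ Suppose that for some $\lambda>0$ $$p(x)\le\Big[\lambda\frac{\pi^4}{L^4}+a\lambda\frac{\pi^2}{L^2}+2b\lambda^2\frac{\pi}{L}\Big]\sin\Big(\frac{\pi x}{L}\Big)+2\lambda c\frac{L}{\pi}\quad\text{for a.e. }x\in(0,L)$$ and $$N\le\frac{4M}{L^3}\,\sigma(\sqrt M\,L),\qquad M:=a+2b\lambda\frac{L}{\pi},\quad N:=c+b\lambda\frac{\pi^2}{L^2}.$$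 Then $\alpha\equiv0$ is a lower solution and $\beta(x)=\lambda\sin(\pi x/L)$ is an upper solution of (P), and $M=a+b\int_0^L\beta\,dx$, $N=c-b\min_{[0,L]}\beta''$. Moreover, for each of the initial functions $y_0=\alpha$ and $y_0=\beta$ the iterative procedure $$y_n''''-My_n''+N\int_0^L y_n\,dt=p+ay_{n-1}''+b\,y_{n-1}''\int_0^L y_{n-1}\,dt-c\int_0^L y_{n-1}\,dt-My_{n-1}''+N\int_0^L y_{n-1}\,dt\quad\text{a.e. in }(0,L),$$ $$y_n(0)=y_n(L)=y_n''(0)=y_n''(L)=0,\qquad n=1,2,\dots,$$ determines a unique sequence in $W^{4,1}[0,L]$; call these sequences $(\alpha_n)$ and $(\beta_n)$. On $[0,L]$ they satisfy, for all $n\ge0$, $\alpha_n\le\alpha_{n+1}$, $\alpha_n\le\beta_n$, $\beta_{n+1}\le\beta_n$ and $\alpha_n''\ge\alpha_{n+1}''$, $\alpha_n''\ge\beta_n''$, $\beta_{n+1}''\ge\beta_n''$. Finally, (P) has solutions $\underline y$ and $\overline y$ in $$[0,\beta]:=\{u\in C^2[0,L]:\ 0\le u\le\beta,\ \ 0\ge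 u''\ge\beta''\}$$ that are its minimum and maximum solutions there, that is, $\underline y\le y\le\overline y$ and $\underline y''\ge y''\ge\overline y''$ for every solution $y\in[0,\beta]$ of (P), and $\alpha_n\to\underline y$, $\beta_n\to\overline y$ uniformly on $[0,L]$. -/

import Mathlib

open MeasureTheory Set Filter

noncomputable section

namespace Melan

/-- The `k`-th derivative of `y` on the interval `[0, L]` (one-sided at the end points). -/
def D (L : ℝ) (k : ℕ) (y : ℝ → ℝ) : ℝ → ℝ := iteratedDerivWithin k y (Icc 0 L)

/-- `y ∈ W^{4,1}[0, L]`, for the continuous representative: `y` is three times continuously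
differentiable on `[0, L]` and `y'''` is absolutely continuous there (so that `y''''` exists
almost everywhere, is integrable, and is the weak derivative of `y'''`). -/
def MemW41 (L : ℝ) (y : ℝ → ℝ) : Prop :=
  ContDiffOn ℝ 3 y (Icc 0 L) ∧ AbsolutelyContinuousOnInterval (D L 3 y) 0 L

/-- Navier boundary conditions `y(0) = y(L) = y''(0) = y''(L) = 0`. -/
def NavierBC (L : ℝ) (y : ℝ → ℝ) : Prop :=
  y 0 = 0 ∧ y L = 0 ∧ D L 2 y 0 = 0 ∧ D L 2 y L = 0

/-- The left-hand side `y'''' - (a + b ∫₀ᴸ y) y'' + c ∫₀ᴸ y` of the Melan equation. -/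
def melanOp (a b c L : ℝ) (y : ℝ → ℝ) (x : ℝ) : ℝ :=
  D L 4 y x - (a + b * ∫ t in (0 : ℝ)..L, y t) * D L 2 y x + c * ∫ t in (0 : ℝ)..L, y t

/-- Solutions of the Melan boundary value problem. -/
def IsSolution (a b c L : ℝ) (p y : ℝ → ℝ) : Prop :=
  MemW41 L y ∧ NavierBC L y ∧ ∀ᵐ x ∂volume.restrict (Ioo 0 L), melanOp a b c L y x = p x

/-- Lower solutions of the Melan boundary value problem. -/
def IsLowerSolution (a b c L : ℝ) (p y : ℝ → ℝ) : Prop :=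
  MemW41 L y ∧ NavierBC L y ∧ ∀ᵐ x ∂volume.restrict (Ioo 0 L), melanOp a b c L y x ≤ p x

/-- Upper solutions of the Melan boundary value problem. -/
def IsUpperSolution (a b c L : ℝ) (p y : ℝ → ℝ) : Prop :=
  MemW41 L y ∧ NavierBC L y ∧ ∀ᵐ x ∂volume.restrict (Ioo 0 L), p x ≤ melanOp a b c L y x

/-- The order used in the monotone method: `u ≤ v` and `u'' ≥ v''` on `[0, L]`. -/
def Below (L : ℝ) (u v : ℝ → ℝ) : Prop :=
  ∀ x ∈ Icc 0 L, u x ≤ v x ∧ D L 2 v x ≤ D L 2 u x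

/-- `u ∈ [α, β]`: `u ∈ C²[0, L]`, `α ≤ u ≤ β` and `α'' ≥ u'' ≥ β''`. -/
def InSector (L : ℝ) (α β u : ℝ → ℝ) : Prop :=
  ContDiffOn ℝ 2 u (Icc 0 L) ∧ Below L α u ∧ Below L u β

/-- `y` is the minimum solution in `[α, β]`. -/
def IsMinSolution (a b c L : ℝ) (p α β y : ℝ → ℝ) : Prop :=
  IsSolution a b c L p y ∧ InSector L α β y ∧
    ∀ z, IsSolution a b c L p z → InSector L α β z → Below L y z

/-- `y` is the maximum solution in `[α, β]`. -/
def IsMaxSolution (a b c L : ℝ) (p α β y : ℝ → ℝ) : Prop :=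
  IsSolution a b c L p y ∧ InSector L α β y ∧
    ∀ z, IsSolution a b c L p z → InSector L α β z → Below L z y

/-- `f(x, ∫₀ᴸ y, y''(x)) = p(x) + a y''(x) + b y''(x) ∫₀ᴸ y - c ∫₀ᴸ y`. -/
def rhs (a b c L : ℝ) (p y : ℝ → ℝ) (x : ℝ) : ℝ :=
  p x + a * D L 2 y x + b * D L 2 y x * (∫ t in (0 : ℝ)..L, y t) - c * ∫ t in (0 : ℝ)..L, y t

/-- The linear operator `G w = w'''' - M w'' + N ∫₀ᴸ w`. -/
def linOp (M N L : ℝ) (w : ℝ → ℝ) (x : ℝ) : ℝ :=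
  D L 4 w x - M * D L 2 w x + N * ∫ t in (0 : ℝ)..L, w t

/-- One step `y ↦ z` of the iterative procedure: `z ∈ W^{4,1}[0, L]` satisfies the Navier
conditions and `G z = f(x, ∫₀ᴸ y, y'') - M y'' + N ∫₀ᴸ y` almost everywhere in `(0, L)`. -/
def IsStep (a b c L M N : ℝ) (p y z : ℝ → ℝ) : Prop :=
  MemW41 L z ∧ NavierBC L z ∧ ∀ᵐ x ∂volume.restrict (Ioo 0 L),
    linOp M N L z x = rhs a b c L p y x - M * D L 2 y x + N * ∫ t in (0 : ℝ)..L, y t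

/-- `y 0, y 1, …` (as functions on `[0, L]`) is produced by the iterative procedure started
at `y₀`. -/
def IsIteration (a b c L M N : ℝ) (p y₀ : ℝ → ℝ) (y : ℕ → ℝ → ℝ) : Prop :=
  EqOn (y 0) y₀ (Icc 0 L) ∧ ∀ n, IsStep a b c L M N p (y n) (y (n + 1))

/-- `y` is the sequence produced by the iterative procedure started at `y₀`, the only one as
far as the values on `[0, L]` are concerned. -/
def IsTheIteration (a b c L M N : ℝ) (p y₀ : ℝ → ℝ) (y : ℕ → ℝ → ℝ) : Prop :=
  IsIteration a b c L M N p y₀ y ∧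
    ∀ z, IsIteration a b c L M N p y₀ z → ∀ n, EqOn (z n) (y n) (Icc 0 L)

/-- `σ(z) = 3 z³ / (6 z cosh z + 6 z - 12 sinh z - z³)`; the denominator is positive for
`z > 0`. -/
def sigma (z : ℝ) : ℝ :=
  3 * z ^ 3 / (6 * z * Real.cosh z + 6 * z - 12 * Real.sinh z - z ^ 3)

end Melan

end

/-! The heart of the matter is a maximum principle for the nonlocal operator `G w = w'''' - M w'' +
N ∫ w` under Navier conditions: `G w ≥ 0` forces `w'' ≤ 0`, hence `w ≥ 0` by concavity. Write `M =
m²`, `v = -w''` and `K = ∫ w`. Then `v` solves the Dirichlet problem `-v'' + m² v = G w - N K`, so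
`v(x) = ∫ g(x,t) (G w)(t) dt - N K e(x)`, where `g` is the Dirichlet Green function and `e` the
response to the load `1` (`representation_linOp`). Testing with `E`, the response to `x (L - x) /
2`, gives `K (1 + N ∫ E) = ∫ (G w) E` (`integral_mul_eq_linOp`). Thus `v ≥ 0` as soon as `N e(x)
E(t) ≤ (1 + N ∫ E) g(x,t)`.

Since `e` and `E` lie below their tangents at the end points while `sinh y ≥ y`, one has `e(x) E(t)
≤ A g(x,t)` with `A = cornerConst m L` (`response_mul_le`). It remains that `N (A - ∫ E) ≤ 1`, and
computing both constants turns this into the bound on `N` by `σ` (`cornerConst_sub`,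
`corner_condition`).

By linearity this becomes a comparison principle in the order `Below` (`below_of_linOp_le`). The
choice of `M` and `N` makes the right-hand side of the iteration increasing for that order below `β`
(`step_mono`), so the iterates are monotone and trapped between `α` and `β`, and any solution in the
sector, being a fixed point, stays between the two sequences. Second derivatives and integrals
converge monotonically; dominated convergence and an `L¹` stability estimate for `G` upgrade this to
uniform convergence to solutions (`iteration_converges`). Finally, `λ sin(π x / L)` can be
differentiated and integrated explicitly, and the assumed bound on `p` is exactly its upper solution
inequality. -/

namespace Melan

/-! ### Functions of class `W^{4,1}` -/

theorem D_zero (L : ℝ) (y : ℝ → ℝ) : D L 0 y = y := iteratedDerivWithin_zero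

theorem D_succ (L : ℝ) (k : ℕ) (y : ℝ → ℝ) :
    D L (k + 1) y = derivWithin (D L k y) (Icc 0 L) := iteratedDerivWithin_succ

theorem D_four_eq_deriv {L x : ℝ} (y : ℝ → ℝ) (hx : x ∈ Ioo 0 L) :
    D L 4 y x = deriv (D L 3 y) x := by
  rw [D_succ, derivWithin_of_mem_nhds (Icc_mem_nhds hx.1 hx.2)]

theorem D_congr {L : ℝ} {u v : ℝ → ℝ} (k : ℕ) (h : EqOn u v (Icc 0 L)) :
    EqOn (D L k u) (D L k v) (Icc 0 L) := iteratedDerivWithin_congr h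

theorem integral_congr_Icc {L : ℝ} (hL : 0 < L) {u v : ℝ → ℝ} (h : EqOn u v (Icc 0 L)) :
    ∫ t in (0 : ℝ)..L, u t = ∫ t in (0 : ℝ)..L, v t :=
  intervalIntegral.integral_congr (by rwa [uIcc_of_le hL.le])

theorem ae_Ioo_iff_Ioc {s t : ℝ} {P : ℝ → Prop} :
    (∀ᵐ x ∂volume.restrict (Ioo s t), P x) ↔ ∀ᵐ x ∂volume.restrict (Ioc s t), P x := by
  rw [Measure.restrict_congr_set (Ioo_ae_eq_Ioc (a := s) (b := t))]

theorem integral_congr_ae_Ioo {s t : ℝ} (hst : s ≤ t) {f g : ℝ → ℝ}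
    (h : ∀ᵐ x ∂volume.restrict (Ioo s t), f x = g x) :
    ∫ x in s..t, f x = ∫ x in s..t, g x :=
  intervalIntegral.integral_congr_ae_restrict (by rw [uIoc_of_le hst]; exact ae_Ioo_iff_Ioc.1 h)

theorem intervalIntegrable_congr_ae_Ioo {s t : ℝ} (hst : s ≤ t) {f g : ℝ → ℝ}
    (h : ∀ᵐ x ∂volume.restrict (Ioo s t), f x = g x) (hf : IntervalIntegrable f volume s t) :
    IntervalIntegrable g volume s t :=
  hf.congr_ae (by rw [uIoc_of_le hst]; exact ae_Ioo_iff_Ioc.1 h)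

theorem hasDerivWithinAt_D {L : ℝ} (hL : 0 < L) {n : ℕ} {y : ℝ → ℝ}
    (hy : ContDiffOn ℝ n y (Icc 0 L)) {k : ℕ} (hk : k < n) {x : ℝ} (hx : x ∈ Icc 0 L) :
    HasDerivWithinAt (D L k y) (D L (k + 1) y x) (Icc 0 L) x := by
  rw [D_succ]
  exact (hy.differentiableOn_iteratedDerivWithin (by exact_mod_cast hk)
    (uniqueDiffOn_Icc hL) x hx).hasDerivWithinAt

theorem continuousOn_D {L : ℝ} (hL : 0 < L) {n : ℕ} {y : ℝ → ℝ}
    (hy : ContDiffOn ℝ n y (Icc 0 L)) {k : ℕ} (hk : k ≤ n) :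
    ContinuousOn (D L k y) (Icc 0 L) :=
  hy.continuousOn_iteratedDerivWithin (by exact_mod_cast hk) (uniqueDiffOn_Icc hL)

namespace MemW41

variable {L : ℝ} {y u v : ℝ → ℝ}

theorem hasDerivWithinAt (hL : 0 < L) (hy : MemW41 L y) {k : ℕ} (hk : k < 3) {x : ℝ}
    (hx : x ∈ Icc 0 L) : HasDerivWithinAt (D L k y) (D L (k + 1) y x) (Icc 0 L) x :=
  hasDerivWithinAt_D hL (n := 3) hy.1 hk hx

theorem continuousOn (hL : 0 < L) (hy : MemW41 L y) {k : ℕ} (hk : k ≤ 3) :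
    ContinuousOn (D L k y) (Icc 0 L) :=
  continuousOn_D hL (n := 3) hy.1 hk

theorem intervalIntegrable_D (hL : 0 < L) (hy : MemW41 L y) {k : ℕ} (hk : k ≤ 3) :
    IntervalIntegrable (D L k y) volume 0 L :=
  (hy.continuousOn hL hk).intervalIntegrable_of_Icc hL.le

theorem continuousOn_self (hL : 0 < L) (hy : MemW41 L y) : ContinuousOn y (Icc 0 L) := by
  simpa [D_zero] using hy.continuousOn hL (k := 0) (by norm_num)

theorem intervalIntegrable (hL : 0 < L) (hy : MemW41 L y) : IntervalIntegrable y volume 0 L :=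
  (hy.continuousOn_self hL).intervalIntegrable_of_Icc hL.le

theorem intervalIntegrable_D_four (hL : 0 < L) (hy : MemW41 L y) :
    IntervalIntegrable (D L 4 y) volume 0 L := by
  refine intervalIntegrable_congr_ae_Ioo hL.le ?_ hy.2.intervalIntegrable_deriv
  filter_upwards [ae_restrict_mem measurableSet_Ioo] with x hx
  exact (D_four_eq_deriv y hx).symm

theorem D_sub (hL : 0 < L) (hu : MemW41 L u) (hv : MemW41 L v) {k : ℕ} (hk : k ≤ 3) {x : ℝ}
    (hx : x ∈ Icc 0 L) : D L k (fun t => u t - v t) x = D L k u x - D L k v x := by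
  have hk' : (k : WithTop ℕ∞) ≤ 3 := by exact_mod_cast hk
  exact iteratedDerivWithin_sub hx (uniqueDiffOn_Icc hL) ((hu.1 x hx).of_le hk')
    ((hv.1 x hx).of_le hk')

theorem sub (hL : 0 < L) (hu : MemW41 L u) (hv : MemW41 L v) :
    MemW41 L (fun t => u t - v t) := by
  refine ⟨hu.1.sub hv.1, ?_⟩
  have h := hu.2.sub hv.2
  -- Absolute continuity only samples end points of subintervals of `[0, L]`, where the third
  -- derivative of the difference is the difference of the third derivatives.
  refine Tendsto.congr' ?_ h
  filter_upwards [mem_inf_of_right (mem_principal_self _)] with E hE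
  refine Finset.sum_congr rfl fun i hi => ?_
  have := hE.1 i hi
  rw [uIcc_of_le hL.le] at this
  rw [hu.D_sub hL hv le_rfl this.1, hu.D_sub hL hv le_rfl this.2]
  rfl

theorem D_four_sub (hL : 0 < L) (hu : MemW41 L u) (hv : MemW41 L v) :
    ∀ᵐ x ∂volume.restrict (Ioo 0 L),
      D L 4 (fun t => u t - v t) x = D L 4 u x - D L 4 v x := by
  have hd := hu.2.ae_differentiableAt
  have hd' := hv.2.ae_differentiableAt
  rw [uIcc_of_le hL.le] at hd hd'
  filter_upwards [ae_restrict_mem measurableSet_Ioo, ae_restrict_of_ae hd, ae_restrict_of_ae hd']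
    with x hx h1 h2
  have hx' := Ioo_subset_Icc_self hx
  rw [D_four_eq_deriv _ hx, D_four_eq_deriv _ hx, D_four_eq_deriv _ hx,
    ← deriv_sub (h1 hx') (h2 hx')]
  refine EventuallyEq.deriv_eq ?_
  filter_upwards [Icc_mem_nhds hx.1 hx.2] with t ht
  exact hu.D_sub hL hv le_rfl ht

end MemW41

/-- A function with three successive derivatives on the line, the last of which is absolutely
continuous on `[0, L]`, is in `W^{4,1}[0, L]`. -/
theorem memW41_of_hasDerivAt {L : ℝ} (hL : 0 < L) {w w₁ w₂ w₃ : ℝ → ℝ}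
    (h₁ : ∀ x, HasDerivAt w (w₁ x) x) (h₂ : ∀ x, HasDerivAt w₁ (w₂ x) x)
    (h₃ : ∀ x, HasDerivAt w₂ (w₃ x) x) (hac : AbsolutelyContinuousOnInterval w₃ 0 L) :
    MemW41 L w ∧ (∀ x ∈ Icc 0 L, D L 2 w x = w₂ x) ∧
      ∀ x ∈ Ioo 0 L, D L 4 w x = deriv w₃ x := by
  have hud := uniqueDiffOn_Icc hL
  have hD1 : EqOn (D L 1 w) w₁ (Icc 0 L) := fun x hx => by
    rw [D_succ, D_zero]; exact (h₁ x).hasDerivWithinAt.derivWithin (hud x hx)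
  have hD2 : EqOn (D L 2 w) w₂ (Icc 0 L) := fun x hx => by
    rw [D_succ, derivWithin_congr hD1 (hD1 hx)]
    exact (h₂ x).hasDerivWithinAt.derivWithin (hud x hx)
  have hD3 : EqOn (D L 3 w) w₃ (Icc 0 L) := fun x hx => by
    rw [D_succ, derivWithin_congr hD2 (hD2 hx)]
    exact (h₃ x).hasDerivWithinAt.derivWithin (hud x hx)
  have hc3 : ContinuousOn w₃ (Icc 0 L) := by simpa [uIcc_of_le hL.le] using hac.continuousOn
  refine ⟨⟨?_, ?_⟩, hD2, fun x hx => ?_⟩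
  · refine (contDiffOn_nat_iff_continuousOn_differentiableOn_deriv (n := 3) hud).2 ⟨?_, ?_⟩
    · intro k hk
      interval_cases k
      · exact (D_zero L w).symm ▸ fun x _ => (h₁ x).continuousAt.continuousWithinAt
      · exact ContinuousOn.congr (fun x _ => (h₂ x).continuousAt.continuousWithinAt) hD1
      · exact ContinuousOn.congr (fun x _ => (h₃ x).continuousAt.continuousWithinAt) hD2
      · exact hc3.congr hD3
    · intro k hk
      interval_cases k
      · exact (D_zero L w).symm ▸ fun x _ => (h₁ x).differentiableAt.differentiableWithinAt
      · exact DifferentiableOn.congr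
          (fun x _ => (h₂ x).differentiableAt.differentiableWithinAt) hD1
      · exact DifferentiableOn.congr
          (fun x _ => (h₃ x).differentiableAt.differentiableWithinAt) hD2
  · refine Tendsto.congr' ?_ hac
    filter_upwards [mem_inf_of_right (mem_principal_self _)] with E hE
    refine Finset.sum_congr rfl fun i hi => ?_
    have := hE.1 i hi
    rw [uIcc_of_le hL.le] at this
    rw [hD3 this.1, hD3 this.2]
  · rw [D_four_eq_deriv _ hx]
    refine EventuallyEq.deriv_eq ?_
    filter_upwards [Icc_mem_nhds hx.1 hx.2] with t ht
    exact hD3 ht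

/-! ### Green's identity and concave functions -/

/-- Green's second identity for `u'' ψ - u ψ''` with `u'` absolutely continuous. -/
theorem green_identity {s t : ℝ} (hst : s ≤ t) {u u₁ u₂ ψ ψ₁ ψ₂ : ℝ → ℝ}
    (hu : ∀ x ∈ Icc s t, HasDerivWithinAt u (u₁ x) (Icc s t) x)
    (hu₁ : AbsolutelyContinuousOnInterval u₁ s t) (hu₂ : ∀ x ∈ Ioo s t, u₂ x = deriv u₁ x)
    (hψ : ∀ x, HasDerivAt ψ (ψ₁ x) x) (hψ₁ : ∀ x, HasDerivAt ψ₁ (ψ₂ x) x)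
    (hψ₂ : Continuous ψ₂) :
    (∫ x in s..t, u₂ x * ψ x) - ∫ x in s..t, u x * ψ₂ x
      = (u₁ t * ψ t - u t * ψ₁ t) - (u₁ s * ψ s - u s * ψ₁ s) := by
  have cψ : Continuous ψ := continuous_iff_continuousAt.2 fun x => (hψ x).continuousAt
  have cψ₁ : Continuous ψ₁ := continuous_iff_continuousAt.2 fun x => (hψ₁ x).continuousAt
  have dψ : deriv ψ = ψ₁ := funext fun x => (hψ x).deriv
  have hacψ : AbsolutelyContinuousOnInterval ψ s t := by
    refine ContDiffOn.absolutelyContinuousOnInterval (ContDiff.contDiffOn ?_)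
    rw [contDiff_one_iff_deriv]
    exact ⟨fun x => (hψ x).differentiableAt, dψ ▸ cψ₁⟩
  have hcu₁ : ContinuousOn u₁ (uIcc s t) := hu₁.continuousOn
  -- Two integrations by parts: the first in its absolutely continuous version, the second classical
  -- because `u₁` is continuous.
  have e1 := hacψ.integral_mul_deriv_eq_deriv_mul hu₁
  rw [← uIcc_of_le hst] at hu
  have e2 := intervalIntegral.integral_mul_deriv_eq_deriv_mul_of_hasDerivWithinAt hu
    (fun x _ => (hψ₁ x).hasDerivWithinAt) hcu₁.intervalIntegrable (hψ₂.intervalIntegrable _ _)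
  rw [dψ] at e1
  have e3 : ∫ x in s..t, u₂ x * ψ x = ∫ x in s..t, ψ x * deriv u₁ x := by
    refine integral_congr_ae_Ioo hst ?_
    filter_upwards [ae_restrict_mem measurableSet_Ioo] with x hx
    rw [hu₂ x hx, mul_comm]
  have e4 : ∫ x in s..t, ψ₁ x * u₁ x = ∫ x in s..t, u₁ x * ψ₁ x := by simp_rw [mul_comm]
  rw [e3, e1, e2, e4]
  ring

/-- A function with nonpositive second derivative vanishing at both ends is nonnegative. -/
theorem nonneg_of_deriv2_nonpos {L : ℝ} {f f₁ f₂ : ℝ → ℝ}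
    (hf : ∀ x ∈ Icc 0 L, HasDerivWithinAt f (f₁ x) (Icc 0 L) x)
    (hf₁ : ∀ x ∈ Icc 0 L, HasDerivWithinAt f₁ (f₂ x) (Icc 0 L) x)
    (hf₂ : ∀ x ∈ Icc 0 L, f₂ x ≤ 0) (h0 : f 0 = 0) (hL : f L = 0) {x : ℝ} (hx : x ∈ Icc 0 L) :
    0 ≤ f x := by
  have hc : ConcaveOn ℝ (Icc 0 L) f := by
    refine concaveOn_of_hasDerivWithinAt2_nonpos (convex_Icc _ _) (f' := f₁) (f'' := f₂)
      (fun y hy => (hf y hy).continuousWithinAt) ?_ ?_ ?_ <;> intro y hy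
    · exact (hf y (interior_subset hy)).mono interior_subset
    · exact (hf₁ y (interior_subset hy)).mono interior_subset
    · exact hf₂ y (interior_subset hy)
  have h := hc.min_le_of_mem_Icc (left_mem_Icc.2 (hx.1.trans hx.2))
    (right_mem_Icc.2 (hx.1.trans hx.2)) hx
  simpa [h0, hL] using h

/-- A function with nonpositive second derivative lies below its tangent at `0`. -/
theorem le_tangent_of_deriv2_nonpos {L : ℝ} {f f₁ f₂ : ℝ → ℝ}
    (hf : ∀ x, HasDerivAt f (f₁ x) x) (hf₁ : ∀ x, HasDerivAt f₁ (f₂ x) x)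
    (hf₂ : ∀ x ∈ Icc 0 L, f₂ x ≤ 0) (h0 : f 0 = 0) {x : ℝ} (hx : x ∈ Icc 0 L) :
    f x ≤ f₁ 0 * x := by
  have hc : ConcaveOn ℝ (Icc 0 L) f := by
    refine concaveOn_of_hasDerivWithinAt2_nonpos (convex_Icc _ _) (f' := f₁) (f'' := f₂)
      (fun y hy => (hf y).continuousAt.continuousWithinAt) ?_ ?_ ?_ <;> intro y hy
    · exact (hf y).hasDerivWithinAt
    · exact (hf₁ y).hasDerivWithinAt
    · exact hf₂ y (interior_subset hy)
  rcases hx.1.eq_or_lt with rfl | hx0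
  · simp [h0]
  have h := hc.slope_le_of_hasDerivWithinAt_Ioi (left_mem_Icc.2 (hx.1.trans hx.2)) hx hx0
    (hf 0).hasDerivWithinAt
  rw [slope_def_field, h0, sub_zero, sub_zero, div_le_iff₀ hx0] at h
  exact h

/-! ### Responses to the constant and parabolic loads, and the corner constant -/

open Real in
/-- The solution of `-e'' + m² e = 1`, `e(0) = e(L) = 0`. -/
noncomputable def unitResponse (m L x : ℝ) : ℝ :=
  (1 - (sinh (m * (L - x)) + sinh (m * x)) / sinh (m * L)) / m ^ 2

open Real in
/-- The derivative of `unitResponse m L`. -/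
noncomputable def unitResponseDeriv (m L x : ℝ) : ℝ :=
  (cosh (m * (L - x)) - cosh (m * x)) / (m * sinh (m * L))

/-- The solution of `-E'' + m² E = x (L - x) / 2`, `E(0) = E(L) = 0`. -/
noncomputable def parabolaResponse (m L x : ℝ) : ℝ :=
  (x * (L - x) / 2 - unitResponse m L x) / m ^ 2

/-- The derivative of `parabolaResponse m L`. -/
noncomputable def parabolaResponseDeriv (m L x : ℝ) : ℝ :=
  ((L - 2 * x) / 2 - unitResponseDeriv m L x) / m ^ 2

/-- The reciprocal of the infimum of `g(x, t) / (e(x) E(t))`, where `g` is the Dirichlet Green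
function of `-v'' + m² v`. -/
noncomputable def cornerConst (m L : ℝ) : ℝ :=
  (Real.cosh (m * L) - 1) * parabolaResponseDeriv m L 0 / m ^ 2

section Responses

variable {m L : ℝ}

theorem hasDerivAt_sinh_mul (m x : ℝ) :
    HasDerivAt (fun t => Real.sinh (m * t)) (m * Real.cosh (m * x)) x := by
  simpa [mul_comm] using ((hasDerivAt_id x).const_mul m).sinh

theorem hasDerivAt_cosh_mul (m x : ℝ) :
    HasDerivAt (fun t => Real.cosh (m * t)) (m * Real.sinh (m * x)) x := by
  simpa [mul_comm] using ((hasDerivAt_id x).const_mul m).cosh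

theorem hasDerivAt_sinh_mul_sub (m L x : ℝ) :
    HasDerivAt (fun t => Real.sinh (m * (L - t))) (-(m * Real.cosh (m * (L - x)))) x := by
  simpa [mul_comm] using (((hasDerivAt_id x).const_sub L).const_mul m).sinh

theorem hasDerivAt_cosh_mul_sub (m L x : ℝ) :
    HasDerivAt (fun t => Real.cosh (m * (L - t))) (-(m * Real.sinh (m * (L - x)))) x := by
  simpa [mul_comm] using (((hasDerivAt_id x).const_sub L).const_mul m).cosh

theorem hasDerivAt_unitResponse (hm : 0 < m) (hL : 0 < L) (x : ℝ) :
    HasDerivAt (unitResponse m L) (unitResponseDeriv m L x) x := by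
  have hs : Real.sinh (m * L) ≠ 0 := (Real.sinh_pos_iff.2 (mul_pos hm hL)).ne'
  refine (((((hasDerivAt_sinh_mul_sub m L x).add (hasDerivAt_sinh_mul m x)).div_const
    (Real.sinh (m * L))).const_sub 1).div_const (m ^ 2)).congr_deriv ?_
  rw [unitResponseDeriv]
  field_simp
  ring

theorem hasDerivAt_unitResponseDeriv (hm : 0 < m) (hL : 0 < L) (x : ℝ) :
    HasDerivAt (unitResponseDeriv m L) (m ^ 2 * unitResponse m L x - 1) x := by
  have hs : Real.sinh (m * L) ≠ 0 := (Real.sinh_pos_iff.2 (mul_pos hm hL)).ne'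
  refine (((hasDerivAt_cosh_mul_sub m L x).sub (hasDerivAt_cosh_mul m x)).div_const
    (m * Real.sinh (m * L))).congr_deriv ?_
  rw [unitResponse]
  field_simp
  ring

theorem hasDerivAt_parabola (L x : ℝ) :
    HasDerivAt (fun t => t * (L - t) / 2) ((L - 2 * x) / 2) x := by
  refine (((hasDerivAt_id x).mul ((hasDerivAt_id x).const_sub L)).div_const 2).congr_deriv ?_
  simp only [id]
  ring

theorem hasDerivAt_parabolaDeriv (L x : ℝ) :
    HasDerivAt (fun t => (L - 2 * t) / 2) (-1) x := by
  refine ((((hasDerivAt_id x).const_mul 2).const_sub L).div_const 2).congr_deriv ?_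
  norm_num

theorem hasDerivAt_parabolaResponse (hm : 0 < m) (hL : 0 < L) (x : ℝ) :
    HasDerivAt (parabolaResponse m L) (parabolaResponseDeriv m L x) x :=
  ((hasDerivAt_parabola L x).sub (hasDerivAt_unitResponse hm hL x)).div_const _

theorem hasDerivAt_parabolaResponseDeriv (hm : 0 < m) (hL : 0 < L) (x : ℝ) :
    HasDerivAt (parabolaResponseDeriv m L) (-unitResponse m L x) x := by
  refine (((hasDerivAt_parabolaDeriv L x).sub
    (hasDerivAt_unitResponseDeriv hm hL x)).div_const _).congr_deriv ?_
  field_simp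
  ring

theorem continuous_unitResponse (hm : 0 < m) (hL : 0 < L) : Continuous (unitResponse m L) :=
  continuous_iff_continuousAt.2 fun x => (hasDerivAt_unitResponse hm hL x).continuousAt

theorem continuous_parabolaResponse (hm : 0 < m) (hL : 0 < L) :
    Continuous (parabolaResponse m L) :=
  continuous_iff_continuousAt.2 fun x => (hasDerivAt_parabolaResponse hm hL x).continuousAt

theorem unitResponse_zero (hm : 0 < m) (hL : 0 < L) : unitResponse m L 0 = 0 := by
  have hs : Real.sinh (m * L) ≠ 0 := (Real.sinh_pos_iff.2 (mul_pos hm hL)).ne'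
  simp [unitResponse, hs]

theorem unitResponse_sub (x : ℝ) : unitResponse m L (L - x) = unitResponse m L x := by
  simp [unitResponse, add_comm]

theorem unitResponse_right (hm : 0 < m) (hL : 0 < L) : unitResponse m L L = 0 := by
  rw [← unitResponse_sub, sub_self, unitResponse_zero hm hL]

theorem parabolaResponse_zero (hm : 0 < m) (hL : 0 < L) : parabolaResponse m L 0 = 0 := by
  simp [parabolaResponse, unitResponse_zero hm hL]

theorem parabolaResponse_sub (x : ℝ) : parabolaResponse m L (L - x) = parabolaResponse m L x := by
  rw [parabolaResponse, unitResponse_sub, parabolaResponse]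
  ring

theorem parabolaResponse_right (hm : 0 < m) (hL : 0 < L) : parabolaResponse m L L = 0 := by
  rw [← parabolaResponse_sub, sub_self, parabolaResponse_zero hm hL]

/-- Concavity of `e`: up to a positive factor the expression is minus a sum of two nonnegative
`sinh` terms. It yields both the sign of `e` and its tangent bound. -/
theorem unitResponse_deriv2_nonpos (hm : 0 < m) (hL : 0 < L) {x : ℝ} (hx : x ∈ Icc 0 L) :
    m ^ 2 * unitResponse m L x - 1 ≤ 0 := by
  have hs : 0 < Real.sinh (m * L) := Real.sinh_pos_iff.2 (mul_pos hm hL)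
  have h1 : 0 ≤ Real.sinh (m * (L - x)) :=
    Real.sinh_nonneg_iff.2 (mul_nonneg hm.le (sub_nonneg.2 hx.2))
  have h2 : 0 ≤ Real.sinh (m * x) := Real.sinh_nonneg_iff.2 (mul_nonneg hm.le hx.1)
  have : 0 ≤ (Real.sinh (m * (L - x)) + Real.sinh (m * x)) / Real.sinh (m * L) := by positivity
  rw [unitResponse, mul_div_cancel₀ _ (pow_ne_zero 2 hm.ne')]
  linarith

theorem unitResponse_nonneg (hm : 0 < m) (hL : 0 < L) {x : ℝ} (hx : x ∈ Icc 0 L) :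
    0 ≤ unitResponse m L x :=
  nonneg_of_deriv2_nonpos (fun x _ => (hasDerivAt_unitResponse hm hL x).hasDerivWithinAt)
    (fun x _ => (hasDerivAt_unitResponseDeriv hm hL x).hasDerivWithinAt)
    (fun _ h => unitResponse_deriv2_nonpos hm hL h)
    (unitResponse_zero hm hL) (unitResponse_right hm hL) hx

theorem parabolaResponse_nonneg (hm : 0 < m) (hL : 0 < L) {x : ℝ} (hx : x ∈ Icc 0 L) :
    0 ≤ parabolaResponse m L x :=
  nonneg_of_deriv2_nonpos (fun x _ => (hasDerivAt_parabolaResponse hm hL x).hasDerivWithinAt)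
    (fun x _ => (hasDerivAt_parabolaResponseDeriv hm hL x).hasDerivWithinAt)
    (fun _ h => neg_nonpos.2 (unitResponse_nonneg hm hL h))
    (parabolaResponse_zero hm hL) (parabolaResponse_right hm hL) hx

theorem unitResponse_le_tangent (hm : 0 < m) (hL : 0 < L) {x : ℝ} (hx : x ∈ Icc 0 L) :
    unitResponse m L x ≤ unitResponseDeriv m L 0 * x :=
  le_tangent_of_deriv2_nonpos (hasDerivAt_unitResponse hm hL) (hasDerivAt_unitResponseDeriv hm hL)
    (fun _ h => unitResponse_deriv2_nonpos hm hL h) (unitResponse_zero hm hL) hx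

theorem parabolaResponse_le_tangent (hm : 0 < m) (hL : 0 < L) {x : ℝ} (hx : x ∈ Icc 0 L) :
    parabolaResponse m L x ≤ parabolaResponseDeriv m L 0 * x :=
  le_tangent_of_deriv2_nonpos (hasDerivAt_parabolaResponse hm hL)
    (hasDerivAt_parabolaResponseDeriv hm hL)
    (fun _ h => neg_nonpos.2 (unitResponse_nonneg hm hL h)) (parabolaResponse_zero hm hL) hx

theorem unitResponseDeriv_zero_nonneg (hm : 0 < m) (hL : 0 < L) :
    0 ≤ unitResponseDeriv m L 0 := by
  have hs : 0 < Real.sinh (m * L) := Real.sinh_pos_iff.2 (mul_pos hm hL)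
  have := Real.one_le_cosh (m * L)
  simp only [unitResponseDeriv, sub_zero, mul_zero, Real.cosh_zero]
  exact div_nonneg (by linarith) (by positivity)

theorem parabolaResponseDeriv_zero_nonneg (hm : 0 < m) (hL : 0 < L) :
    0 ≤ parabolaResponseDeriv m L 0 := by
  have h := parabolaResponse_le_tangent hm hL (right_mem_Icc.2 hL.le)
  rw [parabolaResponse_right hm hL] at h
  exact nonneg_of_mul_nonneg_left h hL

theorem cornerConst_nonneg (hm : 0 < m) (hL : 0 < L) : 0 ≤ cornerConst m L := by
  have := parabolaResponseDeriv_zero_nonneg hm hL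
  have h := sub_nonneg.2 (Real.one_le_cosh (m * L))
  unfold cornerConst
  positivity

/-- The product `e(x) E(t)` is dominated by the Green function. -/
theorem response_mul_le (hm : 0 < m) (hL : 0 < L) {x t : ℝ} (hx : x ∈ Icc 0 L)
    (ht : t ∈ Icc 0 L) :
    m * Real.sinh (m * L) * unitResponse m L x * parabolaResponse m L t
      ≤ cornerConst m L * (Real.sinh (m * x) * Real.sinh (m * t)) := by
  have hs : 0 < Real.sinh (m * L) := Real.sinh_pos_iff.2 (mul_pos hm hL)
  have he := unitResponse_le_tangent hm hL hx
  have hE := parabolaResponse_le_tangent hm hL ht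
  have hmx : 0 ≤ m * x := mul_nonneg hm.le hx.1
  have hmt : 0 ≤ m * t := mul_nonneg hm.le ht.1
  have hp : unitResponse m L x * parabolaResponse m L t
      ≤ (unitResponseDeriv m L 0 * x) * (parabolaResponseDeriv m L 0 * t) :=
    mul_le_mul he hE (parabolaResponse_nonneg hm hL ht)
      (mul_nonneg (unitResponseDeriv_zero_nonneg hm hL) hx.1)
  have hq : (m * x) * (m * t) ≤ Real.sinh (m * x) * Real.sinh (m * t) :=
    mul_le_mul (Real.self_le_sinh_iff.2 hmx) (Real.self_le_sinh_iff.2 hmt) hmt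
      (Real.sinh_nonneg_iff.2 hmx)
  calc m * Real.sinh (m * L) * unitResponse m L x * parabolaResponse m L t
      = m * Real.sinh (m * L) * (unitResponse m L x * parabolaResponse m L t) := by ring
    _ ≤ m * Real.sinh (m * L)
        * ((unitResponseDeriv m L 0 * x) * (parabolaResponseDeriv m L 0 * t)) := by gcongr
    _ = cornerConst m L * ((m * x) * (m * t)) := by
        rw [cornerConst]
        generalize parabolaResponseDeriv m L 0 = d
        simp only [unitResponseDeriv, sub_zero, mul_zero, Real.cosh_zero]
        field_simp
    _ ≤ _ := by gcongr; exact cornerConst_nonneg hm hL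

theorem integral_unitResponse (hm : 0 < m) (hL : 0 < L) :
    ∫ t in (0 : ℝ)..L, unitResponse m L t
      = (L - 2 * (Real.cosh (m * L) - 1) / (m * Real.sinh (m * L))) / m ^ 2 := by
  have h : ∀ x, HasDerivAt (fun x => (x - unitResponseDeriv m L 0 + unitResponseDeriv m L x) / m ^ 2)
      (unitResponse m L x) x := fun x => by
    refine ((((hasDerivAt_id x).sub_const _).add
      (hasDerivAt_unitResponseDeriv hm hL x)).div_const _).congr_deriv ?_
    field_simp
    ring
  rw [intervalIntegral.integral_eq_sub_of_hasDerivAt (fun x _ => h x)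
    ((continuous_unitResponse hm hL).intervalIntegrable _ _)]
  simp only [unitResponseDeriv, sub_zero, mul_zero, Real.cosh_zero, sub_self]
  ring

theorem integral_parabolaResponse (hm : 0 < m) (hL : 0 < L) :
    ∫ t in (0 : ℝ)..L, parabolaResponse m L t
      = (L ^ 3 / 12 - (L - 2 * (Real.cosh (m * L) - 1) / (m * Real.sinh (m * L))) / m ^ 2)
        / m ^ 2 := by
  have h : ∀ x, HasDerivAt (fun x : ℝ => L * x ^ 2 / 4 - x ^ 3 / 6) (x * (L - x) / 2) x :=
    fun x => by
      refine ((((hasDerivAt_pow 2 x).const_mul L).div_const 4).sub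
        ((hasDerivAt_pow 3 x).div_const 6)).congr_deriv ?_
      simp
      ring
  have hi : ∫ t in (0 : ℝ)..L, t * (L - t) / 2 = L ^ 3 / 12 := by
    rw [intervalIntegral.integral_eq_sub_of_hasDerivAt (fun x _ => h x)
      ((by fun_prop : Continuous fun t : ℝ => t * (L - t) / 2).intervalIntegrable _ _)]
    ring
  simp only [parabolaResponse]
  rw [intervalIntegral.integral_div, intervalIntegral.integral_sub
    ((by fun_prop : Continuous fun t : ℝ => t * (L - t) / 2).intervalIntegrable _ _)
    ((continuous_unitResponse hm hL).intervalIntegrable _ _), hi, integral_unitResponse hm hL]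

theorem integral_parabolaResponse_nonneg (hm : 0 < m) (hL : 0 < L) :
    0 ≤ ∫ t in (0 : ℝ)..L, parabolaResponse m L t :=
  intervalIntegral.integral_nonneg hL.le fun _ ht => parabolaResponse_nonneg hm hL ht

/-- This identity is where `σ` comes from: its denominator is, up to the factor `12 m⁵`, the excess
of the corner constant over `∫ E`. -/
theorem cornerConst_sub (hm : 0 < m) (hL : 0 < L) :
    12 * m ^ 5 * (cornerConst m L - ∫ t in (0 : ℝ)..L, parabolaResponse m L t)
      = 6 * (m * L) * Real.cosh (m * L) + 6 * (m * L) - 12 * Real.sinh (m * L) - (m * L) ^ 3 := by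
  have hs : Real.sinh (m * L) ≠ 0 := (Real.sinh_pos_iff.2 (mul_pos hm hL)).ne'
  have hc := Real.cosh_sq (m * L)
  rw [integral_parabolaResponse hm hL, cornerConst, parabolaResponseDeriv]
  simp only [unitResponseDeriv, sub_zero, mul_zero, Real.cosh_zero]
  generalize hS : Real.sinh (m * L) = S at *
  generalize Real.cosh (m * L) = c at *
  have hm' := hm.ne'
  field_simp
  -- Once denominators are cleared, only `cosh² = sinh² + 1` is needed.
  linear_combination (-24) * hc

/-- The bound on `N` in terms of `σ` makes the corner constant dominate. -/
theorem corner_condition (hm : 0 < m) (hL : 0 < L) {N : ℝ} (hN : 0 < N)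
    (h : N ≤ 4 * m ^ 2 / L ^ 3 * sigma (m * L)) :
    0 < cornerConst m L ∧
      N * cornerConst m L ≤ 1 + N * ∫ t in (0 : ℝ)..L, parabolaResponse m L t := by
  have hsub := cornerConst_sub hm hL
  have hC := integral_parabolaResponse_nonneg hm hL
  rw [sigma] at h
  set d := 6 * (m * L) * Real.cosh (m * L) + 6 * (m * L) - 12 * Real.sinh (m * L) - (m * L) ^ 3
  -- Positivity of the denominator is forced by `0 < N ≤ …`: for `d ≤ 0`, including the default
  -- value of division at `d = 0`, the upper bound for `N` would be nonpositive.
  have hd : 0 < d := by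
    by_contra hd
    have : 3 * (m * L) ^ 3 / d ≤ 0 := div_nonpos_of_nonneg_of_nonpos (by positivity) (not_lt.1 hd)
    have : 4 * m ^ 2 / L ^ 3 * (3 * (m * L) ^ 3 / d) ≤ 0 :=
      mul_nonpos_of_nonneg_of_nonpos (by positivity) this
    linarith
  have h' : N * d ≤ 12 * m ^ 5 := by
    rw [← le_div_iff₀ hd]
    refine h.trans_eq ?_
    field_simp
    ring
  have hm5 : 0 < 12 * m ^ 5 := by positivity
  have hpos : 0 < cornerConst m L - ∫ t in (0 : ℝ)..L, parabolaResponse m L t :=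
    pos_of_mul_pos_right (hsub ▸ hd) hm5.le
  refine ⟨by linarith, ?_⟩
  have : 12 * m ^ 5 * (N * (cornerConst m L - ∫ t in (0 : ℝ)..L, parabolaResponse m L t))
      ≤ 12 * m ^ 5 * 1 := by
    calc _ = N * d := by rw [← hsub]; ring
      _ ≤ _ := by linarith
  have := le_of_mul_le_mul_left this hm5
  linarith

end Responses

/-! ### Representation of `w''` and the maximum principle for the linear operator -/

section Linear

variable {m N L : ℝ} {w : ℝ → ℝ}

theorem intervalIntegrable_linOp {M : ℝ} (hL : 0 < L) (hw : MemW41 L w) :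
    IntervalIntegrable (linOp M N L w) volume 0 L :=
  ((hw.intervalIntegrable_D_four hL).sub
    ((hw.intervalIntegrable_D hL (k := 2) (by norm_num)).const_mul M)).add
    intervalIntegrable_const

/-- Green's identity for `w''`. -/
theorem green_D_two (hL : 0 < L) (hw : MemW41 L w) {s t : ℝ} (hs : 0 ≤ s) (hst : s ≤ t)
    (ht : t ≤ L) {ψ ψ₁ ψ₂ : ℝ → ℝ} (hψ : ∀ x, HasDerivAt ψ (ψ₁ x) x)
    (hψ₁ : ∀ x, HasDerivAt ψ₁ (ψ₂ x) x) (hψ₂ : Continuous ψ₂) :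
    (∫ x in s..t, D L 4 w x * ψ x) - ∫ x in s..t, D L 2 w x * ψ₂ x
      = (D L 3 w t * ψ t - D L 2 w t * ψ₁ t) - (D L 3 w s * ψ s - D L 2 w s * ψ₁ s) := by
  have hsub : Icc s t ⊆ Icc 0 L := Icc_subset_Icc hs ht
  refine green_identity hst
    (fun x hx => (hw.hasDerivWithinAt hL (k := 2) (by norm_num) (hsub hx)).mono hsub)
    (hw.2.mono (by rwa [uIcc_of_le hst, uIcc_of_le hL.le]))
    (fun x hx => D_four_eq_deriv _ ⟨hs.trans_lt hx.1, hx.2.trans_le ht⟩) hψ hψ₁ hψ₂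

/-- Green's identity for `w` and the parabola `x (L - x) / 2`. -/
theorem integral_D_two_mul_parabola (hL : 0 < L) (hw : MemW41 L w) (hbc : NavierBC L w) :
    ∫ x in (0 : ℝ)..L, D L 2 w x * (x * (L - x) / 2) = -∫ x in (0 : ℝ)..L, w x := by
  have hd0 : ∀ x ∈ Icc 0 L, HasDerivWithinAt w (D L 1 w x) (Icc 0 L) x := fun x hx => by
    simpa [D_zero] using hw.hasDerivWithinAt hL (k := 0) (by norm_num) hx
  have hD1 : ContDiffOn ℝ 1 (D L 1 w) (uIcc 0 L) := by
    rw [uIcc_of_le hL.le]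
    refine (contDiffOn_one_iff_derivWithin (uniqueDiffOn_Icc hL)).2 ⟨fun x hx =>
      (hw.hasDerivWithinAt hL (k := 1) (by norm_num) hx).differentiableWithinAt, ?_⟩
    rw [← D_succ]
    exact hw.continuousOn hL (by norm_num)
  have h := green_identity hL.le hd0 hD1.absolutelyContinuousOnInterval (u₂ := D L 2 w)
    (fun x hx => by rw [D_succ, derivWithin_of_mem_nhds (Icc_mem_nhds hx.1 hx.2)])
    (hasDerivAt_parabola L) (hasDerivAt_parabolaDeriv L) continuous_const
  rw [hbc.1, hbc.2.1, intervalIntegral.integral_mul_const] at h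
  linear_combination h

/-- The integral of `w` in terms of `w'''' - m² w''`. -/
theorem integral_mul_parabolaResponse (hm : 0 < m) (hL : 0 < L) (hw : MemW41 L w)
    (hbc : NavierBC L w) :
    ∫ x in (0 : ℝ)..L, (D L 4 w x - m ^ 2 * D L 2 w x) * parabolaResponse m L x
      = ∫ x in (0 : ℝ)..L, w x := by
  have cE := continuous_parabolaResponse hm hL
  have ce := continuous_unitResponse hm hL
  have h := green_D_two hL hw le_rfl hL.le le_rfl (hasDerivAt_parabolaResponse hm hL)
    (hasDerivAt_parabolaResponseDeriv hm hL) ce.neg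
  rw [parabolaResponse_zero hm hL, parabolaResponse_right hm hL, hbc.2.2.1, hbc.2.2.2] at h
  have h2 := integral_D_two_mul_parabola hL hw hbc
  have i4 := (hw.intervalIntegrable_D_four hL).mul_continuousOn cE.continuousOn
  have i2 := hw.intervalIntegrable_D hL (k := 2) (by norm_num)
  have i2e : IntervalIntegrable (fun x => D L 2 w x * -unitResponse m L x) volume 0 L :=
    i2.mul_continuousOn ce.neg.continuousOn
  have i2q := i2.mul_continuousOn
    (by fun_prop : Continuous fun x : ℝ => x * (L - x) / 2).continuousOn
  have key : ∫ x in (0 : ℝ)..L, (D L 4 w x - m ^ 2 * D L 2 w x) * parabolaResponse m L x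
      = (∫ x in (0 : ℝ)..L, D L 4 w x * parabolaResponse m L x)
        - (∫ x in (0 : ℝ)..L, D L 2 w x * (x * (L - x) / 2))
        - ∫ x in (0 : ℝ)..L, D L 2 w x * -unitResponse m L x := by
    rw [← intervalIntegral.integral_sub i4 i2q, ← intervalIntegral.integral_sub (i4.sub i2q) i2e]
    refine intervalIntegral.integral_congr fun x _ => ?_
    simp only [parabolaResponse]
    field_simp
    ring
  linear_combination key + h - h2

/-- The representation of `-w''` by the Dirichlet Green function of `-v'' + m² v`. -/
theorem representation (hL : 0 < L) (hw : MemW41 L w) (hbc : NavierBC L w)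
    {x : ℝ} (hx : x ∈ Icc 0 L) :
    m * Real.sinh (m * L) * (-D L 2 w x)
      = Real.sinh (m * (L - x))
          * (∫ t in (0 : ℝ)..x, (D L 4 w t - m ^ 2 * D L 2 w t) * Real.sinh (m * t))
        + Real.sinh (m * x)
          * ∫ t in x..L, (D L 4 w t - m ^ 2 * D L 2 w t) * Real.sinh (m * (L - t)) := by
  have i4 := hw.intervalIntegrable_D_four hL
  have i2 := hw.intervalIntegrable_D hL (k := 2) (by norm_num)
  have c1 : Continuous fun t => Real.sinh (m * t) := by fun_prop
  have c2 : Continuous fun t => Real.sinh (m * (L - t)) := by fun_prop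
  have split : ∀ {s t : ℝ} {ψ : ℝ → ℝ}, 0 ≤ s → s ≤ t → t ≤ L → Continuous ψ →
      ∫ x in s..t, (D L 4 w x - m ^ 2 * D L 2 w x) * ψ x
        = (∫ x in s..t, D L 4 w x * ψ x) - ∫ x in s..t, D L 2 w x * (m * (m * ψ x)) := by
    intro s t ψ hs hst ht hψ
    have hsub : uIcc s t ⊆ uIcc 0 L := by
      rw [uIcc_of_le hst, uIcc_of_le hL.le]; exact Icc_subset_Icc hs ht
    rw [← intervalIntegral.integral_sub ((i4.mono_set hsub).mul_continuousOn hψ.continuousOn)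
      ((i2.mono_set hsub).mul_continuousOn (by fun_prop))]
    refine intervalIntegral.integral_congr fun x _ => ?_
    ring
  -- Green's identity on each side of `x`, with the solution of `ψ'' = m² ψ` vanishing at the outer
  -- end. In the combination below the terms in `w'''(x)` cancel, and the addition formula collects
  -- the coefficient of `w''(x)`.
  have g1 := green_D_two hL hw le_rfl hx.1 hx.2 (hasDerivAt_sinh_mul m)
    (ψ₂ := fun t => m * (m * Real.sinh (m * t)))
    (fun t => (hasDerivAt_cosh_mul m t).const_mul m) (by fun_prop)
  have g2 := green_D_two hL hw hx.1 hx.2 le_rfl (hasDerivAt_sinh_mul_sub m L)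
    (ψ₂ := fun t => m * (m * Real.sinh (m * (L - t))))
    (fun t => (((hasDerivAt_cosh_mul_sub m L t).const_mul m).neg).congr_deriv (by ring))
    (by fun_prop)
  rw [split le_rfl hx.1 hx.2 c1, split hx.1 hx.2 le_rfl c2, g1, g2, hbc.2.2.1, hbc.2.2.2]
  have ha : Real.sinh (m * L) = Real.sinh (m * (L - x)) * Real.cosh (m * x)
      + Real.cosh (m * (L - x)) * Real.sinh (m * x) := by
    rw [← Real.sinh_add]; congr 1; ring
  rw [ha]
  simp only [mul_zero, Real.sinh_zero, sub_self]
  ring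

theorem integral_sinh_mul (hm : 0 < m) (x : ℝ) :
    ∫ t in (0 : ℝ)..x, Real.sinh (m * t) = (Real.cosh (m * x) - 1) / m := by
  rw [intervalIntegral.integral_eq_sub_of_hasDerivAt
    (f := fun t => Real.cosh (m * t) / m)
    (fun t _ => ((hasDerivAt_cosh_mul m t).div_const m).congr_deriv (by field_simp))
    ((by fun_prop : Continuous fun t => Real.sinh (m * t)).intervalIntegrable _ _)]
  simp
  ring

theorem integral_sinh_mul_sub (hm : 0 < m) (x : ℝ) :
    ∫ t in x..L, Real.sinh (m * (L - t)) = (Real.cosh (m * (L - x)) - 1) / m := by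
  rw [intervalIntegral.integral_comp_sub_left (fun t => Real.sinh (m * t)) L, sub_self,
    integral_sinh_mul hm]

/-- The part of the representation of `-w''` that depends on `linOp`. -/
noncomputable def greenIntegral (m L : ℝ) (h : ℝ → ℝ) (x : ℝ) : ℝ :=
  Real.sinh (m * (L - x)) * (∫ t in (0 : ℝ)..x, h t * Real.sinh (m * t))
    + Real.sinh (m * x) * ∫ t in x..L, h t * Real.sinh (m * (L - t))

/-- The Green integral of a constant is a multiple of `e`; this separates the nonlocal term from
`linOp`. -/
theorem greenIntegral_sub_const (hm : 0 < m) (hL : 0 < L) {h : ℝ → ℝ}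
    (hi : IntervalIntegrable h volume 0 L) (k : ℝ) {x : ℝ} (hx : x ∈ Icc 0 L) :
    greenIntegral m L (fun t => h t - k) x
      = greenIntegral m L h x - k * (m * Real.sinh (m * L) * unitResponse m L x) := by
  have hs : Real.sinh (m * L) ≠ 0 := (Real.sinh_pos_iff.2 (mul_pos hm hL)).ne'
  have c1 : Continuous fun t => Real.sinh (m * t) := by fun_prop
  have c2 : Continuous fun t => Real.sinh (m * (L - t)) := by fun_prop
  have hx1 : uIcc 0 x ⊆ uIcc 0 L := by
    rw [uIcc_of_le hx.1, uIcc_of_le hL.le]; exact Icc_subset_Icc le_rfl hx.2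
  have hx2 : uIcc x L ⊆ uIcc 0 L := by
    rw [uIcc_of_le hx.2, uIcc_of_le hL.le]; exact Icc_subset_Icc hx.1 le_rfl
  have ha : Real.sinh (m * L) = Real.sinh (m * (L - x)) * Real.cosh (m * x)
      + Real.cosh (m * (L - x)) * Real.sinh (m * x) := by
    rw [← Real.sinh_add]; congr 1; ring
  simp only [greenIntegral, sub_mul]
  rw [intervalIntegral.integral_sub ((hi.mono_set hx1).mul_continuousOn c1.continuousOn)
      ((c1.const_mul k).intervalIntegrable _ _),
    intervalIntegral.integral_sub ((hi.mono_set hx2).mul_continuousOn c2.continuousOn)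
      ((c2.const_mul k).intervalIntegrable _ _),
    intervalIntegral.integral_const_mul, intervalIntegral.integral_const_mul,
    integral_sinh_mul hm, integral_sinh_mul_sub hm]
  have hu : m * Real.sinh (m * L) * unitResponse m L x
      = (Real.sinh (m * L) - Real.sinh (m * (L - x)) - Real.sinh (m * x)) / m := by
    rw [unitResponse]; field_simp; ring
  rw [hu, ha]
  ring

theorem representation_linOp (hm : 0 < m) (hL : 0 < L) (hw : MemW41 L w) (hbc : NavierBC L w)
    {x : ℝ} (hx : x ∈ Icc 0 L) :
    m * Real.sinh (m * L) * (-D L 2 w x)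
      = greenIntegral m L (linOp (m ^ 2) N L w) x
        - N * (∫ t in (0 : ℝ)..L, w t) * (m * Real.sinh (m * L) * unitResponse m L x) := by
  rw [representation hL hw hbc hx,
    ← greenIntegral_sub_const hm hL (intervalIntegrable_linOp hL hw) _ hx]
  simp only [greenIntegral, linOp, add_sub_cancel_right]

/-- Testing with `E` closes the equation for the unknown number `∫ w`, expressing it through `linOp`
alone. -/
theorem integral_mul_eq_linOp (hm : 0 < m) (hL : 0 < L) (hw : MemW41 L w) (hbc : NavierBC L w) :
    (∫ t in (0 : ℝ)..L, w t) * (1 + N * ∫ t in (0 : ℝ)..L, parabolaResponse m L t)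
      = ∫ t in (0 : ℝ)..L, linOp (m ^ 2) N L w t * parabolaResponse m L t := by
  have cE := continuous_parabolaResponse hm hL
  have h := integral_mul_parabolaResponse hm hL hw hbc
  have h2 : ∫ x in (0 : ℝ)..L, (D L 4 w x - m ^ 2 * D L 2 w x) * parabolaResponse m L x
      = ∫ x in (0 : ℝ)..L, (linOp (m ^ 2) N L w x * parabolaResponse m L x
        - N * (∫ t in (0 : ℝ)..L, w t) * parabolaResponse m L x) := by
    refine intervalIntegral.integral_congr fun x _ => ?_
    simp only [linOp]
    ring
  rw [intervalIntegral.integral_sub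
    ((intervalIntegrable_linOp hL hw).mul_continuousOn cE.continuousOn)
    ((cE.const_mul _).intervalIntegrable _ _), intervalIntegral.integral_const_mul] at h2
  linear_combination h2 - h

theorem integral_nonneg_Ioo {s t : ℝ} (hst : s ≤ t) {f : ℝ → ℝ}
    (h : ∀ᵐ x ∂volume.restrict (Ioo s t), 0 ≤ f x) : 0 ≤ ∫ x in s..t, f x :=
  intervalIntegral.integral_nonneg_of_ae_restrict hst
    (by rwa [← Measure.restrict_congr_set Ioo_ae_eq_Icc])

theorem integral_mono_Ioo {s t : ℝ} (hst : s ≤ t) {f g : ℝ → ℝ}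
    (hf : IntervalIntegrable f volume s t) (hg : IntervalIntegrable g volume s t)
    (h : ∀ᵐ x ∂volume.restrict (Ioo s t), f x ≤ g x) :
    ∫ x in s..t, f x ≤ ∫ x in s..t, g x :=
  intervalIntegral.integral_mono_ae_restrict hst hf hg
    (by rwa [← Measure.restrict_congr_set Ioo_ae_eq_Icc])

/-- The pointwise bound `response_mul_le`, integrated against `h ≥ 0`. The Green function changes
its formula at `t = x`, so the two ranges are treated separately; reflection `y ↦ L - y` is applied
to `x` on the left and to `t` on the right. -/
theorem greenIntegral_ge (hm : 0 < m) (hL : 0 < L) {h : ℝ → ℝ}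
    (hi : IntervalIntegrable h volume 0 L) (h0 : ∀ᵐ x ∂volume.restrict (Ioo 0 L), 0 ≤ h x)
    {x : ℝ} (hx : x ∈ Icc 0 L) :
    m * Real.sinh (m * L) * unitResponse m L x * (∫ t in (0 : ℝ)..L, h t * parabolaResponse m L t)
      ≤ cornerConst m L * greenIntegral m L h x := by
  have cE := continuous_parabolaResponse hm hL
  have c1 : Continuous fun t => Real.sinh (m * t) := by fun_prop
  have c2 : Continuous fun t => Real.sinh (m * (L - t)) := by fun_prop
  have hx1 : uIcc 0 x ⊆ uIcc 0 L := by
    rw [uIcc_of_le hx.1, uIcc_of_le hL.le]; exact Icc_subset_Icc le_rfl hx.2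
  have hx2 : uIcc x L ⊆ uIcc 0 L := by
    rw [uIcc_of_le hx.2, uIcc_of_le hL.le]; exact Icc_subset_Icc hx.1 le_rfl
  have hi1 := hi.mono_set hx1
  have hi2 := hi.mono_set hx2
  set P := m * Real.sinh (m * L) * unitResponse m L x with hP
  set A := cornerConst m L with hA
  have hx' : L - x ∈ Icc 0 L := ⟨sub_nonneg.2 hx.2, by linarith [hx.1]⟩
  have b1 : P * (∫ t in (0 : ℝ)..x, h t * parabolaResponse m L t)
      ≤ A * Real.sinh (m * (L - x)) * ∫ t in (0 : ℝ)..x, h t * Real.sinh (m * t) := by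
    rw [← intervalIntegral.integral_const_mul, ← intervalIntegral.integral_const_mul]
    refine integral_mono_Ioo hx.1 ((hi1.mul_continuousOn cE.continuousOn).const_mul _)
      ((hi1.mul_continuousOn c1.continuousOn).const_mul _) ?_
    filter_upwards [ae_restrict_mem measurableSet_Ioo,
      ae_restrict_of_ae_restrict_of_subset (Ioo_subset_Ioo le_rfl hx.2) h0] with t ht hht
    have := response_mul_le hm hL hx' ⟨ht.1.le, ht.2.le.trans hx.2⟩
    rw [unitResponse_sub, ← hP, ← hA] at this
    nlinarith [mul_le_mul_of_nonneg_left this hht]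
  have b2 : P * (∫ t in x..L, h t * parabolaResponse m L t)
      ≤ A * Real.sinh (m * x) * ∫ t in x..L, h t * Real.sinh (m * (L - t)) := by
    rw [← intervalIntegral.integral_const_mul, ← intervalIntegral.integral_const_mul]
    refine integral_mono_Ioo hx.2 ((hi2.mul_continuousOn cE.continuousOn).const_mul _)
      ((hi2.mul_continuousOn c2.continuousOn).const_mul _) ?_
    filter_upwards [ae_restrict_mem measurableSet_Ioo,
      ae_restrict_of_ae_restrict_of_subset (Ioo_subset_Ioo hx.1 le_rfl) h0] with t ht hht
    have := response_mul_le hm hL hx (t := L - t) ⟨sub_nonneg.2 ht.2.le, by linarith [ht.1, hx.1]⟩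
    rw [parabolaResponse_sub, ← hP, ← hA] at this
    nlinarith [mul_le_mul_of_nonneg_left this hht]
  rw [greenIntegral, ← intervalIntegral.integral_add_adjacent_intervals
    (hi1.mul_continuousOn cE.continuousOn) (hi2.mul_continuousOn cE.continuousOn)]
  linarith

/-- Nonnegativity of `w` follows from that of `-w''`. -/
theorem nonneg_of_D_two_nonpos (hL : 0 < L) (hw : MemW41 L w) (hbc : NavierBC L w)
    (h : ∀ x ∈ Icc 0 L, D L 2 w x ≤ 0) {x : ℝ} (hx : x ∈ Icc 0 L) : 0 ≤ w x :=
  nonneg_of_deriv2_nonpos (f₁ := D L 1 w) (f₂ := D L 2 w)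
    (fun x hx => by simpa [D_zero] using hw.hasDerivWithinAt hL (k := 0) (by norm_num) hx)
    (fun x hx => hw.hasDerivWithinAt hL (k := 1) (by norm_num) hx) h hbc.1 hbc.2.1 hx

/-- The maximum principle for `w'''' - m² w'' + N ∫ w` under Navier conditions. -/
theorem D_two_nonpos_of_linOp_nonneg (hm : 0 < m) (hL : 0 < L) (hN : 0 < N)
    (hσ : N ≤ 4 * m ^ 2 / L ^ 3 * sigma (m * L)) (hw : MemW41 L w) (hbc : NavierBC L w)
    (h : ∀ᵐ x ∂volume.restrict (Ioo 0 L), 0 ≤ linOp (m ^ 2) N L w x) {x : ℝ}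
    (hx : x ∈ Icc 0 L) : D L 2 w x ≤ 0 := by
  obtain ⟨hA, hNA⟩ := corner_condition hm hL hN hσ
  have hC := integral_parabolaResponse_nonneg hm hL
  have hK := integral_mul_eq_linOp (N := N) hm hL hw hbc
  have hr := representation_linOp (N := N) hm hL hw hbc hx
  have hg := greenIntegral_ge hm hL (intervalIntegrable_linOp hL hw) h hx
  have hE0 : 0 ≤ ∫ t in (0 : ℝ)..L, linOp (m ^ 2) N L w t * parabolaResponse m L t := by
    refine integral_nonneg_Ioo hL.le ?_
    filter_upwards [ae_restrict_mem measurableSet_Ioo, h] with t ht hht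
    exact mul_nonneg hht (parabolaResponse_nonneg hm hL (Ioo_subset_Icc_self ht))
  have he := unitResponse_nonneg hm hL hx
  have hs : 0 < Real.sinh (m * L) := Real.sinh_pos_iff.2 (mul_pos hm hL)
  rw [← hK] at hg hE0
  set C := ∫ t in (0 : ℝ)..L, parabolaResponse m L t
  set K := ∫ t in (0 : ℝ)..L, w t
  have hK0 : 0 ≤ K := nonneg_of_mul_nonneg_left hE0 (by positivity)
  set S := m * Real.sinh (m * L) with hS
  have hS0 : 0 < S := mul_pos hm hs
  have h1 : 0 ≤ S * unitResponse m L x * K * (1 + N * C - N * cornerConst m L) := by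
    have : 0 ≤ 1 + N * C - N * cornerConst m L := by linarith
    positivity
  -- After multiplication by the corner constant, the Green integral dominates `S e(x) K (1 + N C)`,
  -- and `h1` absorbs the nonlocal term.
  have h2 : cornerConst m L * (S * (-D L 2 w x)) = cornerConst m L *
    (greenIntegral m L (linOp (m ^ 2) N L w) x - N * K * (S * unitResponse m L x)) := by rw [hr]
  have h3 : 0 ≤ cornerConst m L * S * (-D L 2 w x) := by nlinarith
  have := nonneg_of_mul_nonneg_right h3 (by positivity)
  linarith

/-! ### Stability of the linear problem in the `L¹` norm -/

theorem abs_integral_mul_le (hL : 0 < L) {h ψ : ℝ → ℝ} (hi : IntervalIntegrable h volume 0 L)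
    {s t c : ℝ} (hs : 0 ≤ s) (hst : s ≤ t) (ht : t ≤ L) (hc : 0 ≤ c)
    (hψ : ∀ x ∈ Icc s t, |ψ x| ≤ c) :
    |∫ x in s..t, h x * ψ x| ≤ c * ∫ x in (0 : ℝ)..L, |h x| := by
  have hsub : uIcc s t ⊆ uIcc 0 L := by
    rw [uIcc_of_le hst, uIcc_of_le hL.le]; exact Icc_subset_Icc hs ht
  calc |∫ x in s..t, h x * ψ x| ≤ ∫ x in s..t, c * |h x| := by
        rw [← Real.norm_eq_abs]
        refine intervalIntegral.norm_integral_le_of_norm_le hst (ae_of_all _ fun x hx => ?_)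
          ((hi.mono_set hsub).abs.const_mul c)
        rw [Real.norm_eq_abs, abs_mul, mul_comm]
        exact mul_le_mul_of_nonneg_right (hψ x (Ioc_subset_Icc_self hx)) (abs_nonneg _)
    _ = c * ∫ x in s..t, |h x| := intervalIntegral.integral_const_mul _ _
    _ ≤ _ := by
        gcongr
        exact intervalIntegral.integral_mono_interval hs hst ht
          (ae_of_all _ fun x => abs_nonneg _) hi.abs

/-- A bound on `w''` gives a bound on `w`. -/
theorem abs_le_of_abs_D_two_le (hL : 0 < L) (hw : MemW41 L w) (hbc : NavierBC L w) {B : ℝ}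
    (h : ∀ x ∈ Icc 0 L, |D L 2 w x| ≤ B) {x : ℝ} (hx : x ∈ Icc 0 L) : |w x| ≤ B * L ^ 2 := by
  have d0 : ∀ x ∈ Icc 0 L, HasDerivWithinAt w (D L 1 w x) (Icc 0 L) x := fun x hx => by
    simpa [D_zero] using hw.hasDerivWithinAt hL (k := 0) (by norm_num) hx
  have d1 : ∀ x ∈ Icc 0 L, HasDerivWithinAt (D L 1 w) (D L 2 w x) (Icc 0 L) x :=
    fun x hx => hw.hasDerivWithinAt hL (k := 1) (by norm_num) hx
  -- Barrier with second derivative `-B`: both its sum with `w` and its difference from `w` are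
  -- concave and vanish at the ends.
  have q0 : ∀ x, HasDerivAt (fun t => B * (t * (L - t) / 2)) (B * ((L - 2 * x) / 2)) x :=
    fun x => (hasDerivAt_parabola L x).const_mul B
  have q1 : ∀ x, HasDerivAt (fun t => B * ((L - 2 * t) / 2)) (B * -1) x :=
    fun x => (hasDerivAt_parabolaDeriv L x).const_mul B
  have h1 := nonneg_of_deriv2_nonpos (fun x hx => (q0 x).hasDerivWithinAt.sub (d0 x hx))
    (fun x hx => (q1 x).hasDerivWithinAt.sub (d1 x hx))
    (fun x hx => by linarith [(abs_le.1 (h x hx)).1]) (by simp [hbc.1]) (by simp [hbc.2.1]) hx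
  have h2 := nonneg_of_deriv2_nonpos (fun x hx => (q0 x).hasDerivWithinAt.add (d0 x hx))
    (fun x hx => (q1 x).hasDerivWithinAt.add (d1 x hx))
    (fun x hx => by linarith [(abs_le.1 (h x hx)).2]) (by simp [hbc.1]) (by simp [hbc.2.1]) hx
  have hB : 0 ≤ B := (abs_nonneg _).trans (h x hx)
  have hq : x * (L - x) / 2 ≤ L ^ 2 := by nlinarith [hx.1, hx.2]
  have := mul_le_mul_of_nonneg_left hq hB
  simp only [Pi.sub_apply, Pi.add_apply] at h1 h2
  rw [abs_le]
  constructor <;> linarith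

/-- Continuous dependence of `w` and `w''` on the `L¹` norm of the right-hand side. -/
theorem exists_stability_const (hm : 0 < m) (hL : 0 < L) (hN : 0 < N) :
    ∃ B : ℝ, ∀ w : ℝ → ℝ, MemW41 L w → NavierBC L w → ∀ x ∈ Icc 0 L,
      |w x| ≤ B * (∫ t in (0 : ℝ)..L, |linOp (m ^ 2) N L w t|) ∧
      |D L 2 w x| ≤ B * ∫ t in (0 : ℝ)..L, |linOp (m ^ 2) N L w t| := by
  have hs : 0 < Real.sinh (m * L) := Real.sinh_pos_iff.2 (mul_pos hm hL)
  set s := Real.sinh (m * L) with hsdef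
  set e₁ := unitResponseDeriv m L 0 * L with he₁
  set E₁ := parabolaResponseDeriv m L 0 * L with hE₁
  have he₁0 : 0 ≤ e₁ := mul_nonneg (unitResponseDeriv_zero_nonneg hm hL) hL.le
  have hE₁0 : 0 ≤ E₁ := mul_nonneg (parabolaResponseDeriv_zero_nonneg hm hL) hL.le
  -- The term `2 s²` bounds the two halves of the Green integral, the other one bounds the nonlocal
  -- term through `|∫ w| ≤ E₁ J` and `e ≤ e₁`.
  set B := (2 * (s * s) + N * E₁ * (m * s * e₁)) / (m * s) with hB
  have hB0 : 0 ≤ B := by positivity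
  have hsinh : ∀ y ∈ Icc 0 L, |Real.sinh (m * y)| ≤ s := fun y hy => by
    rw [abs_of_nonneg (Real.sinh_nonneg_iff.2 (mul_nonneg hm.le hy.1))]
    exact Real.sinh_le_sinh.2 (mul_le_mul_of_nonneg_left hy.2 hm.le)
  refine ⟨B + B * L ^ 2, fun w hw hbc => ?_⟩
  have hi := intervalIntegrable_linOp (M := m ^ 2) (N := N) hL hw
  set J := ∫ t in (0 : ℝ)..L, |linOp (m ^ 2) N L w t| with hJ
  have hJ0 : 0 ≤ J := intervalIntegral.integral_nonneg hL.le fun _ _ => abs_nonneg _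
  have hK : |∫ t in (0 : ℝ)..L, w t| ≤ E₁ * J := by
    have hC := integral_parabolaResponse_nonneg hm hL
    have h1 := integral_mul_eq_linOp (N := N) hm hL hw hbc
    have h2 := abs_integral_mul_le hL hi (ψ := parabolaResponse m L) le_rfl hL.le le_rfl hE₁0
      (fun x hx => by
        rw [abs_of_nonneg (parabolaResponse_nonneg hm hL hx)]
        exact (parabolaResponse_le_tangent hm hL hx).trans
          (mul_le_mul_of_nonneg_left hx.2 (parabolaResponseDeriv_zero_nonneg hm hL)))
    rw [← h1, abs_mul] at h2
    -- The factor `1 + N ∫ E` is at least `1` and may be dropped.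
    refine le_trans (le_mul_of_one_le_right (abs_nonneg _) ?_) h2
    exact le_trans (by nlinarith) (le_abs_self _)
  have hD : ∀ x ∈ Icc 0 L, |D L 2 w x| ≤ B * J := fun x hx => by
    have hr := representation_linOp (N := N) hm hL hw hbc hx
    have hx' : L - x ∈ Icc 0 L := ⟨sub_nonneg.2 hx.2, by linarith [hx.1]⟩
    have g1 := abs_integral_mul_le hL hi (ψ := fun t => Real.sinh (m * t)) le_rfl hx.1 hx.2 hs.le
      (fun t ht => hsinh t ⟨ht.1, ht.2.trans hx.2⟩)
    have g2 := abs_integral_mul_le hL hi (ψ := fun t => Real.sinh (m * (L - t))) hx.1 hx.2 le_rfl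
      hs.le (fun t ht => hsinh (L - t) ⟨sub_nonneg.2 ht.2, by linarith [hx.1.trans ht.1]⟩)
    have g : |greenIntegral m L (linOp (m ^ 2) N L w) x| ≤ s * (s * J) + s * (s * J) := by
      rw [greenIntegral]
      refine (abs_add_le _ _).trans (add_le_add ?_ ?_) <;> rw [abs_mul]
      · exact mul_le_mul (hsinh _ hx') g1 (abs_nonneg _) hs.le
      · exact mul_le_mul (hsinh _ hx) g2 (abs_nonneg _) hs.le
    have he0 := unitResponse_nonneg hm hL hx
    have he : unitResponse m L x ≤ e₁ := (unitResponse_le_tangent hm hL hx).trans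
      (mul_le_mul_of_nonneg_left hx.2 (unitResponseDeriv_zero_nonneg hm hL))
    have hk : |N * (∫ t in (0 : ℝ)..L, w t) * (m * s * unitResponse m L x)|
        ≤ N * (E₁ * J) * (m * s * e₁) := by
      rw [abs_mul, abs_mul, abs_of_pos hN, abs_of_nonneg (by positivity : 0 ≤ m * s * _)]
      gcongr
    have ha : m * s * |D L 2 w x| ≤ s * (s * J) + s * (s * J) + N * (E₁ * J) * (m * s * e₁) := by
      have : m * s * |D L 2 w x| = |m * s * (-D L 2 w x)| := by
        rw [abs_mul, abs_neg, abs_of_pos (mul_pos hm hs)]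
      rw [this, hr]
      exact (abs_sub _ _).trans (add_le_add g hk)
    rw [← mul_le_mul_iff_right₀ (mul_pos hm hs)]
    refine ha.trans_eq ?_
    rw [hB]
    field_simp
    ring
  intro x hx
  have h1 := abs_le_of_abs_D_two_le hL hw hbc hD hx
  have h2 := hD x hx
  have h3 : 0 ≤ B * J := mul_nonneg hB0 hJ0
  have h4 : 0 ≤ B * J * L ^ 2 := by positivity
  constructor <;> nlinarith

end Linear

/-! ### Solvability of the linear problem -/

section Existence

variable {m N L : ℝ}

theorem hasDerivAt_primitive {f : ℝ → ℝ} (hf : Continuous f) (x : ℝ) :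
    HasDerivAt (fun x => ∫ t in (0 : ℝ)..x, f t) (f x) x :=
  intervalIntegral.integral_hasDerivAt_right (hf.intervalIntegrable _ _)
    (hf.stronglyMeasurableAtFilter _ _) hf.continuousAt

/-- The equation `s'' = m² (s - Q)` with continuous `Q` has a solution with `s(0) = 0`. -/
theorem exists_forced_solution (m : ℝ) {Q : ℝ → ℝ} (hQ : Continuous Q) :
    ∃ s s₁ : ℝ → ℝ, (∀ x, HasDerivAt s (s₁ x) x) ∧
      (∀ x, HasDerivAt s₁ (m ^ 2 * (s x - Q x)) x) ∧ s 0 = 0 := by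
  have hc : Continuous fun t => Real.cosh (m * t) * Q t := by fun_prop
  have hs : Continuous fun t => Real.sinh (m * t) * Q t := by fun_prop
  -- Variation of constants, `s(x) = -m ∫₀ˣ sinh(m (x - t)) Q(t) dt`, with the kernel expanded so
  -- that only primitives are differentiated.
  refine ⟨fun x => -m * (Real.sinh (m * x) * (∫ t in (0 : ℝ)..x, Real.cosh (m * t) * Q t)
      - Real.cosh (m * x) * ∫ t in (0 : ℝ)..x, Real.sinh (m * t) * Q t),
    fun x => -m ^ 2 * (Real.cosh (m * x) * (∫ t in (0 : ℝ)..x, Real.cosh (m * t) * Q t)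
      - Real.sinh (m * x) * ∫ t in (0 : ℝ)..x, Real.sinh (m * t) * Q t), fun x => ?_, fun x => ?_,
    by simp⟩
  · refine ((((hasDerivAt_sinh_mul m x).mul (hasDerivAt_primitive hc x)).sub
      ((hasDerivAt_cosh_mul m x).mul (hasDerivAt_primitive hs x))).const_mul (-m)).congr_deriv ?_
    ring
  · refine ((((hasDerivAt_cosh_mul m x).mul (hasDerivAt_primitive hc x)).sub
      ((hasDerivAt_sinh_mul m x).mul
        (hasDerivAt_primitive hs x))).const_mul (-m ^ 2)).congr_deriv ?_
    linear_combination (-m ^ 2 * Q x) * Real.cosh_sq (m * x)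

/-- Solvability of `w'''' - m² w'' = f` under Navier conditions, for `f ∈ L¹`. -/
theorem exists_navier_solution (hm : 0 < m) (hL : 0 < L) {f : ℝ → ℝ}
    (hf : IntervalIntegrable f volume 0 L) :
    ∃ w, MemW41 L w ∧ NavierBC L w ∧
      ∀ᵐ x ∂volume.restrict (Ioo 0 L), D L 4 w x - m ^ 2 * D L 2 w x = f x := by
  have hsL : Real.sinh (m * L) ≠ 0 := (Real.sinh_pos_iff.2 (mul_pos hm hL)).ne'
  -- Extension by zero gives primitives on the whole line.
  set g : ℝ → ℝ := (Ioc 0 L).indicator f with hg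
  have hgi : Integrable g := by
    rw [hg, integrable_indicator_iff measurableSet_Ioc]
    exact (intervalIntegrable_iff_integrableOn_Ioc_of_le hL.le).1 hf
  set P : ℝ → ℝ := fun x => ∫ t in (0 : ℝ)..x, g t with hP
  have hPc : Continuous P :=
    intervalIntegral.continuous_primitive (fun a b => hgi.intervalIntegrable) 0
  have hPac : AbsolutelyContinuousOnInterval P 0 L :=
    (hgi.intervalIntegrable (a := 0) (b := L)).absolutelyContinuousOnInterval_intervalIntegral
      left_mem_uIcc
  have hPd := (hgi.intervalIntegrable (a := 0) (b := L)).ae_hasDerivAt_integral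
  set Q : ℝ → ℝ := fun x => ∫ t in (0 : ℝ)..x, P t with hQ
  have hQd : ∀ x, HasDerivAt Q (P x) x := hasDerivAt_primitive hPc
  have hQc : Continuous Q := continuous_iff_continuousAt.2 fun x => (hQd x).continuousAt
  have hQ0 : Q 0 = 0 := by simp [hQ]
  obtain ⟨s, s₁, hs, hs₁, hs0⟩ := exists_forced_solution m hQc
  -- Here `v` plays the role of `-w''`. Splitting off `Q`, a second primitive of `g`, confines the
  -- `L¹` datum to `P = Q'`, so that `v' = r - P` with `r` of class `C¹`. The constant `k` makes
  -- `v(L) = 0`.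
  set k : ℝ := -(s L - Q L) / Real.sinh (m * L) with hk
  set v : ℝ → ℝ := fun x => s x - Q x + k * Real.sinh (m * x) with hv
  set r : ℝ → ℝ := fun x => s₁ x + k * (m * Real.cosh (m * x)) with hr
  have hvd : ∀ x, HasDerivAt v (r x - P x) x := fun x =>
    (((hs x).sub (hQd x)).add ((hasDerivAt_sinh_mul m x).const_mul k)).congr_deriv (by
      simp only [hr]; ring)
  have hrd : ∀ x, HasDerivAt r (m ^ 2 * v x) x := fun x =>
    ((hs₁ x).add (((hasDerivAt_cosh_mul m x).const_mul m).const_mul k)).congr_deriv (by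
      simp only [hv]; ring)
  have hvc : Continuous v := continuous_iff_continuousAt.2 fun x => (hvd x).continuousAt
  have hrac : AbsolutelyContinuousOnInterval r 0 L := by
    refine ContDiffOn.absolutelyContinuousOnInterval (ContDiff.contDiffOn ?_)
    rw [contDiff_one_iff_deriv]
    refine ⟨fun x => (hrd x).differentiableAt, ?_⟩
    rw [funext fun x => (hrd x).deriv]
    fun_prop
  have hv0 : v 0 = 0 := by simp [hv, hs0, hQ0]
  have hvL : v L = 0 := by simp only [hv, hk]; field_simp; ring
  set V : ℝ → ℝ := fun x => ∫ t in (0 : ℝ)..x, v t with hV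
  have hVd : ∀ x, HasDerivAt V (v x) x := hasDerivAt_primitive hvc
  have hVc : Continuous V := continuous_iff_continuousAt.2 fun x => (hVd x).continuousAt
  -- The slope for which `w(L) = 0`.
  set c : ℝ := (∫ t in (0 : ℝ)..L, V t) / L with hc
  obtain ⟨hmem, hD2, hD4⟩ := memW41_of_hasDerivAt hL
    (w := fun x => c * x - ∫ t in (0 : ℝ)..x, V t) (w₁ := fun x => c - V x)
    (w₂ := fun x => -v x) (w₃ := fun x => P x - r x)
    (fun x => (((hasDerivAt_id x).const_mul c).sub
      (hasDerivAt_primitive hVc x)).congr_deriv (by simp))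
    (fun x => (hVd x).const_sub c)
    (fun x => (hvd x).neg.congr_deriv (by ring)) (hPac.sub hrac)
  refine ⟨_, hmem, ⟨by simp, ?_, ?_, ?_⟩, ?_⟩
  · simp only [hc]; field_simp; ring
  · rw [hD2 0 (left_mem_Icc.2 hL.le), hv0, neg_zero]
  · rw [hD2 L (right_mem_Icc.2 hL.le), hvL, neg_zero]
  · filter_upwards [ae_restrict_mem measurableSet_Ioo, ae_restrict_of_ae hPd] with x hx hPx
    have hx' := Ioo_subset_Icc_self hx
    have hPx' : HasDerivAt P (g x) x :=
      hPx (by rwa [uIcc_of_le hL.le]) 0 left_mem_uIcc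
    rw [hD4 x hx, hD2 x hx', (hPx'.fun_sub (hrd x)).deriv, hg,
      indicator_of_mem (Ioo_subset_Ioc_self hx)]
    ring

/-- Solvability of `w'''' - m² w'' + N ∫ w = h` under Navier conditions, for `h ∈ L¹`. -/
theorem exists_linear_solution (hm : 0 < m) (hL : 0 < L) (hN : 0 < N) {h : ℝ → ℝ}
    (hh : IntervalIntegrable h volume 0 L) :
    ∃ w, MemW41 L w ∧ NavierBC L w ∧
      ∀ᵐ x ∂volume.restrict (Ioo 0 L), linOp (m ^ 2) N L w x = h x := by
  have cE := continuous_parabolaResponse hm hL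
  have hC := integral_parabolaResponse_nonneg hm hL
  set C := ∫ t in (0 : ℝ)..L, parabolaResponse m L t with hCdef
  -- The only value that `∫ w` can take, by `integral_mul_eq_linOp`. Solving the local problem with
  -- this constant inserted yields a `w` whose integral is indeed `K`.
  set K := (∫ t in (0 : ℝ)..L, h t * parabolaResponse m L t) / (1 + N * C) with hK
  have h1 : 1 + N * C ≠ 0 := by positivity
  obtain ⟨w, hw, hbc, hwe⟩ := exists_navier_solution hm hL
    (hh.sub (intervalIntegrable_const (c := N * K)))
  have hint : ∫ t in (0 : ℝ)..L, w t = K := by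
    rw [← integral_mul_parabolaResponse hm hL hw hbc]
    have : ∫ x in (0 : ℝ)..L, (D L 4 w x - m ^ 2 * D L 2 w x) * parabolaResponse m L x
        = ∫ x in (0 : ℝ)..L, (h x * parabolaResponse m L x
          - N * K * parabolaResponse m L x) := by
      refine integral_congr_ae_Ioo hL.le ?_
      filter_upwards [hwe] with x hx
      rw [hx]
      ring
    rw [this, intervalIntegral.integral_sub (hh.mul_continuousOn cE.continuousOn)
      ((cE.const_mul _).intervalIntegrable _ _), intervalIntegral.integral_const_mul, ← hCdef]
    have : ∫ t in (0 : ℝ)..L, h t * parabolaResponse m L t = K * (1 + N * C) := by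
      rw [hK]; field_simp
    rw [this]
    ring
  refine ⟨w, hw, hbc, ?_⟩
  filter_upwards [hwe] with x hx
  rw [linOp, hx, hint]
  ring

end Existence

/-! ### Comparison and the iteration step -/

theorem NavierBC.sub {L : ℝ} (hL : 0 < L) {u v : ℝ → ℝ} (hu : MemW41 L u) (hv : MemW41 L v)
    (hbu : NavierBC L u) (hbv : NavierBC L v) : NavierBC L (fun t => u t - v t) := by
  obtain ⟨u1, u2, u3, u4⟩ := hbu
  obtain ⟨v1, v2, v3, v4⟩ := hbv
  refine ⟨by simp [u1, v1], by simp [u2, v2], ?_, ?_⟩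
  · rw [hu.D_sub hL hv (by norm_num) (left_mem_Icc.2 hL.le), u3, v3, sub_zero]
  · rw [hu.D_sub hL hv (by norm_num) (right_mem_Icc.2 hL.le), u4, v4, sub_zero]

theorem linOp_sub {M N L : ℝ} (hL : 0 < L) {u v : ℝ → ℝ} (hu : MemW41 L u) (hv : MemW41 L v) :
    ∀ᵐ x ∂volume.restrict (Ioo 0 L),
      linOp M N L (fun t => u t - v t) x = linOp M N L u x - linOp M N L v x := by
  filter_upwards [hu.D_four_sub hL hv, ae_restrict_mem measurableSet_Ioo] with x hx hx'
  rw [linOp, hx, hu.D_sub hL hv (by norm_num) (Ioo_subset_Icc_self hx'),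
    intervalIntegral.integral_sub (hu.intervalIntegrable hL) (hv.intervalIntegrable hL),
    linOp, linOp]
  ring

/-- The maximum principle applied to `v - u`, with `m = √M`. -/
theorem below_of_linOp_le {M N L : ℝ} (hM : 0 < M) (hL : 0 < L) (hN : 0 < N)
    (hσ : N ≤ 4 * M / L ^ 3 * sigma (Real.sqrt M * L)) {u v : ℝ → ℝ} (hu : MemW41 L u)
    (hv : MemW41 L v) (hbu : NavierBC L u) (hbv : NavierBC L v)
    (h : ∀ᵐ x ∂volume.restrict (Ioo 0 L), linOp M N L u x ≤ linOp M N L v x) : Below L u v := by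
  have hd := hv.sub hL hu
  have hbd := hbv.sub hL hv hu hbu
  have hsq : M = Real.sqrt M ^ 2 := (Real.sq_sqrt hM.le).symm
  have key : ∀ x ∈ Icc 0 L, D L 2 (fun t => v t - u t) x ≤ 0 := fun x hx => by
    refine D_two_nonpos_of_linOp_nonneg (Real.sqrt_pos.2 hM) hL hN (by rwa [← hsq]) hd hbd ?_ hx
    rw [← hsq]
    filter_upwards [linOp_sub hL hv hu, h] with t ht ht'
    rw [ht]
    linarith
  refine fun x hx => ⟨?_, ?_⟩
  · have := nonneg_of_D_two_nonpos hL hd hbd key hx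
    linarith
  · have := key x hx
    rw [hv.D_sub hL hu (by norm_num) hx] at this
    linarith

theorem Below.refl (L : ℝ) (u : ℝ → ℝ) : Below L u u := fun _ _ => ⟨le_rfl, le_rfl⟩

theorem Below.trans {L : ℝ} {u v w : ℝ → ℝ} (h : Below L u v) (h' : Below L v w) : Below L u w :=
  fun x hx => ⟨(h x hx).1.trans (h' x hx).1, (h' x hx).2.trans (h x hx).2⟩

theorem Below.eqOn {L : ℝ} {u v : ℝ → ℝ} (h : Below L u v) (h' : Below L v u) :
    EqOn u v (Icc 0 L) := fun x hx => le_antisymm (h x hx).1 (h' x hx).1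

theorem Below.integral_le {L : ℝ} (hL : 0 < L) {u v : ℝ → ℝ} (h : Below L u v)
    (hu : MemW41 L u) (hv : MemW41 L v) :
    ∫ t in (0 : ℝ)..L, u t ≤ ∫ t in (0 : ℝ)..L, v t :=
  intervalIntegral.integral_mono_on hL.le (hu.intervalIntegrable hL) (hv.intervalIntegrable hL)
    fun x hx => (h x hx).1

/-- The right-hand side of one step of the iterative procedure. -/
noncomputable def stepRhs (a b c L M N : ℝ) (p y : ℝ → ℝ) (x : ℝ) : ℝ :=
  rhs a b c L p y x - M * D L 2 y x + N * ∫ t in (0 : ℝ)..L, y t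

/-- The linear step differs from the Melan equation only by its residual. Hence lower and upper
solutions compare with their own iterates, and solutions are fixed points. -/
theorem linOp_eq_melanOp (a b c L M N : ℝ) (p y : ℝ → ℝ) (x : ℝ) :
    linOp M N L y x = melanOp a b c L y x - p x + stepRhs a b c L M N p y x := by
  simp only [linOp, melanOp, stepRhs, rhs]
  ring

theorem intervalIntegrable_stepRhs {a b c L M N : ℝ} (hL : 0 < L) {p y : ℝ → ℝ}
    (hp : IntegrableOn p (Icc 0 L)) (hy : MemW41 L y) :
    IntervalIntegrable (stepRhs a b c L M N p y) volume 0 L := by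
  have hp' : IntervalIntegrable p volume 0 L :=
    (intervalIntegrable_iff_integrableOn_Icc_of_le hL.le).2 hp
  have h2 := hy.intervalIntegrable_D hL (k := 2) (by norm_num)
  exact ((((hp'.add (h2.const_mul a)).add ((h2.const_mul b).mul_const _)).sub
    intervalIntegrable_const).sub (h2.const_mul M)).add intervalIntegrable_const

theorem exists_isStep {a b c L M N : ℝ} (hL : 0 < L) (hM : 0 < M) (hN : 0 < N) {p y : ℝ → ℝ}
    (hp : IntegrableOn p (Icc 0 L)) (hy : MemW41 L y) : ∃ z, IsStep a b c L M N p y z := by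
  obtain ⟨z, hz⟩ := exists_linear_solution (Real.sqrt_pos.2 hM) hL hN
    (intervalIntegrable_stepRhs (a := a) (b := b) (c := c) (M := M) (N := N) hL hp hy)
  rw [Real.sq_sqrt hM.le] at hz
  exact ⟨z, hz⟩

/-- An upper bound `β` together with coefficients `M`, `N` for which the iterative procedure is
monotone on functions below `β`. -/
structure MonotoneSetting (a b c L M N : ℝ) (p β : ℝ → ℝ) : Prop where
  hL : 0 < L
  hb : 0 < b
  hM : 0 < M
  hN : 0 < N
  hσ : N ≤ 4 * M / L ^ 3 * sigma (Real.sqrt M * L)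
  hp : IntegrableOn p (Icc 0 L)
  memβ : MemW41 L β
  M_eq : M = a + b * ∫ t in (0 : ℝ)..L, β t
  N_ge : ∀ x ∈ Icc 0 L, 0 ≤ N - c + b * D L 2 β x

namespace MonotoneSetting

variable {a b c L M N : ℝ} {p β : ℝ → ℝ} (S : MonotoneSetting a b c L M N p β)
include S

theorem step_unique {u u' z z' : ℝ → ℝ} (h : EqOn u u' (Icc 0 L))
    (hz : IsStep a b c L M N p u z) (hz' : IsStep a b c L M N p u' z') :
    EqOn z z' (Icc 0 L) := by
  have hae : ∀ᵐ x ∂volume.restrict (Ioo 0 L), linOp M N L z x = linOp M N L z' x := by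
    filter_upwards [hz.2.2, hz'.2.2, ae_restrict_mem measurableSet_Ioo] with x h1 h2 hx
    rw [h1, h2, rhs, rhs, D_congr 2 h (Ioo_subset_Icc_self hx), integral_congr_Icc S.hL h]
  refine Below.eqOn (below_of_linOp_le S.hM S.hL S.hN S.hσ hz.1 hz'.1 hz.2.1 hz'.2.1
    (hae.mono fun x hx => hx.le)) (below_of_linOp_le S.hM S.hL S.hN S.hσ hz'.1 hz.1 hz'.2.1 hz.2.1
    (hae.mono fun x hx => hx.ge))

/-- With `F` the right-hand side of a step, `F(v) - F(u) = (M - a - b ∫ v) (u'' - v'') + (∫ v - ∫ u)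
(N - c + b u'')`. All factors are nonnegative, since `∫ v ≤ ∫ β` and `u'' ≥ β''`. -/
theorem step_mono {u v u' v' : ℝ → ℝ} (hu : MemW41 L u) (hv : MemW41 L v) (huv : Below L u v)
    (hvβ : Below L v β) (hu' : IsStep a b c L M N p u u') (hv' : IsStep a b c L M N p v v') :
    Below L u' v' := by
  refine below_of_linOp_le S.hM S.hL S.hN S.hσ hu'.1 hv'.1 hu'.2.1 hv'.2.1 ?_
  filter_upwards [hu'.2.2, hv'.2.2, ae_restrict_mem measurableSet_Ioo] with x h1 h2 hx
  have hx' := Ioo_subset_Icc_self hx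
  rw [h1, h2, rhs, rhs]
  have i1 := huv.integral_le S.hL hu hv
  have i2 := hvβ.integral_le S.hL hv S.memβ
  have d1 := (huv x hx').2
  have d2 := ((huv.trans hvβ) x hx').2
  have hN := S.N_ge x hx'
  have hb := S.hb
  have hM : a + b * (∫ t in (0 : ℝ)..L, v t) ≤ M := by
    rw [S.M_eq]; gcongr
  have hN' : 0 ≤ N - c + b * D L 2 u x := by nlinarith
  nlinarith [mul_nonneg (sub_nonneg.2 d1) (sub_nonneg.2 hM), mul_nonneg (sub_nonneg.2 i1) hN']

theorem below_step_of_lower {y z : ℝ → ℝ} (hy : IsLowerSolution a b c L p y)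
    (hz : IsStep a b c L M N p y z) : Below L y z := by
  refine below_of_linOp_le S.hM S.hL S.hN S.hσ hy.1 hz.1 hy.2.1 hz.2.1 ?_
  filter_upwards [hy.2.2, hz.2.2] with x h1 h2
  rw [h2, linOp_eq_melanOp a b c L M N p y, stepRhs]
  linarith

theorem step_below_of_upper {y z : ℝ → ℝ} (hy : IsUpperSolution a b c L p y)
    (hz : IsStep a b c L M N p y z) : Below L z y := by
  refine below_of_linOp_le S.hM S.hL S.hN S.hσ hz.1 hy.1 hz.2.1 hy.2.1 ?_
  filter_upwards [hy.2.2, hz.2.2] with x h1 h2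
  rw [h2, linOp_eq_melanOp a b c L M N p y, stepRhs]
  linarith

omit S in
theorem isStep_self_of_isSolution {y : ℝ → ℝ} (hy : IsSolution a b c L p y) :
    IsStep a b c L M N p y y := by
  refine ⟨hy.1, hy.2.1, ?_⟩
  filter_upwards [hy.2.2] with x h1
  rw [linOp_eq_melanOp a b c L M N p y, stepRhs, h1]
  ring

theorem exists_iteration {y₀ : ℝ → ℝ} (h₀ : MemW41 L y₀) :
    ∃ y : ℕ → ℝ → ℝ, y 0 = y₀ ∧ (∀ n, MemW41 L (y n)) ∧
      IsTheIteration a b c L M N p y₀ y := by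
  -- A total step map, arbitrary outside `W^{4,1}`, so that it can be iterated.
  have hT : ∀ u, ∃ z, MemW41 L u → IsStep a b c L M N p u z := fun u => by
    by_cases hu : MemW41 L u
    · obtain ⟨z, hz⟩ := exists_isStep (a := a) (b := b) (c := c) S.hL S.hM S.hN S.hp hu
      exact ⟨z, fun _ => hz⟩
    · exact ⟨u, fun h => absurd h hu⟩
  choose T hT using hT
  have hmem : ∀ n, MemW41 L (T^[n] y₀) := fun n => by
    induction n with
    | zero => exact h₀
    | succ n ih => rw [Function.iterate_succ_apply']; exact (hT _ ih).1
  have hstep : ∀ n, IsStep a b c L M N p (T^[n] y₀) (T^[n + 1] y₀) := fun n => by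
    rw [Function.iterate_succ_apply']; exact hT _ (hmem n)
  refine ⟨fun n => T^[n] y₀, rfl, hmem, ⟨fun _ _ => rfl, hstep⟩, fun z hz n => ?_⟩
  induction n with
  | zero => exact hz.1
  | succ n ih => exact S.step_unique ih (hz.2 n) (hstep n)

/-- Serves also for shifted sequences and for constant sequences at a solution; the latter case
gives extremality of the limits. -/
theorem below_iteration {y z : ℕ → ℝ → ℝ} (hy : ∀ n, MemW41 L (y n)) (hz : ∀ n, MemW41 L (z n))
    (hys : ∀ n, IsStep a b c L M N p (y n) (y (n + 1)))
    (hzs : ∀ n, IsStep a b c L M N p (z n) (z (n + 1))) (h0 : Below L (y 0) (z 0))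
    (hzβ : ∀ n, Below L (z n) β) (n : ℕ) : Below L (y n) (z n) := by
  induction n with
  | zero => exact h0
  | succ n ih => exact S.step_mono (hy n) (hz n) ih (hzβ n) (hys n) (hzs n)

end MonotoneSetting

/-! ### Convergence of the iteration -/

theorem dist_integral_le {L : ℝ} (hL : 0 < L) {u v : ℝ → ℝ} (hu : MemW41 L u) (hv : MemW41 L v)
    {δ : ℝ} (h : ∀ x ∈ Icc 0 L, |u x - v x| ≤ δ) :
    |(∫ t in (0 : ℝ)..L, u t) - ∫ t in (0 : ℝ)..L, v t| ≤ δ * L := by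
  rw [← intervalIntegral.integral_sub (hu.intervalIntegrable hL) (hv.intervalIntegrable hL)]
  have := intervalIntegral.norm_integral_le_of_norm_le_const (a := 0) (b := L)
    (f := fun t => u t - v t) (C := δ) fun x hx => by
      rw [uIoc_of_le hL.le] at hx
      exact h x (Ioc_subset_Icc_self hx)
  rwa [sub_zero, abs_of_pos hL] at this

/-- If the second derivatives and the integrals of the iterates converge, and the former are
uniformly bounded, then the iterates converge uniformly to a solution. -/
theorem iteration_converges {a b c L M N : ℝ} (hL : 0 < L) (hM : 0 < M) (hN : 0 < N)
    {p : ℝ → ℝ} (hp : IntegrableOn p (Icc 0 L)) {y : ℕ → ℝ → ℝ} (hy : ∀ n, MemW41 L (y n))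
    (hys : ∀ n, IsStep a b c L M N p (y n) (y (n + 1))) {B : ℝ}
    (hB : ∀ n, ∀ x ∈ Icc 0 L, |D L 2 (y n) x| ≤ B)
    (hlim : ∀ x ∈ Icc 0 L, ∃ l, Tendsto (fun n => D L 2 (y n) x) atTop (nhds l))
    (hint : ∃ κ, Tendsto (fun n => ∫ t in (0 : ℝ)..L, y n t) atTop (nhds κ)) :
    ∃ z, IsSolution a b c L p z ∧ TendstoUniformlyOn y z atTop (Icc 0 L) ∧
      ∀ x ∈ Icc 0 L, Tendsto (fun n => D L 2 (y n) x) atTop (nhds (D L 2 z x)) := by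
  choose! l hl using hlim
  obtain ⟨κ, hκ⟩ := hint
  have hp' : IntervalIntegrable p volume 0 L :=
    (intervalIntegrable_iff_integrableOn_Icc_of_le hL.le).2 hp
  have hlB : ∀ x ∈ Icc 0 L, |l x| ≤ B := fun x hx =>
    le_of_tendsto ((hl x hx).abs) (Eventually.of_forall fun n => hB n x hx)
  have hli : IntervalIntegrable l volume 0 L := by
    have hmeas : AEStronglyMeasurable l (volume.restrict (uIoc 0 L)) := by
      rw [uIoc_of_le hL.le]
      refine aestronglyMeasurable_of_tendsto_ae atTop (f := fun n => D L 2 (y n)) (fun n => ?_) ?_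
      · exact (((hy n).continuousOn hL (k := 2) (by norm_num)).mono
          Ioc_subset_Icc_self).aestronglyMeasurable measurableSet_Ioc
      · filter_upwards [ae_restrict_mem measurableSet_Ioc] with x hx
        exact hl x (Ioc_subset_Icc_self hx)
    refine (intervalIntegrable_const (c := B)).mono_fun hmeas ?_
    rw [uIoc_of_le hL.le]
    filter_upwards [ae_restrict_mem measurableSet_Ioc] with x hx
    exact (hlB x (Ioc_subset_Icc_self hx)).trans (le_abs_self B)
  -- The pointwise limit of the right-hand sides. The limit `z` is defined by solving the linear
  -- problem with this datum, before `l` is known to be a second derivative.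
  set h : ℝ → ℝ := fun x => p x + a * l x + b * l x * κ - c * κ - M * l x + N * κ with hh
  have hhi : IntervalIntegrable h volume 0 L :=
    ((((hp'.add (hli.const_mul a)).add ((hli.const_mul b).mul_const _)).sub
      intervalIntegrable_const).sub (hli.const_mul M)).add intervalIntegrable_const
  obtain ⟨z, hz, hbz, hze⟩ := exists_linear_solution (Real.sqrt_pos.2 hM) hL hN hhi
  obtain ⟨R, hR⟩ := exists_stability_const (Real.sqrt_pos.2 hM) hL hN
  rw [Real.sq_sqrt hM.le] at hze hR
  set J : ℕ → ℝ := fun n => ∫ t in (0 : ℝ)..L, |stepRhs a b c L M N p (y n) t - h t| with hJ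
  have hJlim : Tendsto J atTop (nhds 0) := by
    obtain ⟨I, hI⟩ := hκ.abs.bddAbove_range
    have hI' : ∀ n, |∫ t in (0 : ℝ)..L, y n t| ≤ I := fun n => hI ⟨n, rfl⟩
    -- The merely integrable `p` cancels in the difference, so a constant dominates.
    have hlim0 := intervalIntegral.tendsto_integral_filter_of_dominated_convergence
      (μ := volume) (a := 0) (b := L) (l := atTop)
      (F := fun n t => |stepRhs a b c L M N p (y n) t - h t|) (f := fun _ => 0)
      (fun _ => |a| * (B + B) + |b| * (B * I + B * |κ|) + |c| * (I + |κ|) + |M| * (B + B)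
        + |N| * (I + |κ|))
      (Eventually.of_forall fun n =>
        ((intervalIntegrable_stepRhs hL hp (hy n)).sub hhi).abs.aestronglyMeasurable_restrict_uIoc)
      (Eventually.of_forall fun n => ae_of_all _ fun x hx => ?_) intervalIntegrable_const
      (ae_of_all _ fun x hx => ?_)
    · simpa using hlim0
    · rw [uIoc_of_le hL.le] at hx
      have hx' := Ioc_subset_Icc_self hx
      have b1 := hB n x hx'
      have b2 := hlB x hx'
      have b3 := hI' n
      have hB0 : 0 ≤ B := (abs_nonneg _).trans b1
      have e : stepRhs a b c L M N p (y n) x - h x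
          = a * (D L 2 (y n) x - l x)
            + b * (D L 2 (y n) x * (∫ t in (0 : ℝ)..L, y n t) - l x * κ)
            + c * (κ - ∫ t in (0 : ℝ)..L, y n t) + M * (l x - D L 2 (y n) x)
            + N * ((∫ t in (0 : ℝ)..L, y n t) - κ) := by
        simp only [stepRhs, rhs, hh]; ring
      rw [norm_abs_eq_norm, Real.norm_eq_abs, e]
      refine (abs_add_le _ _).trans (add_le_add ((abs_add_le _ _).trans (add_le_add
        ((abs_add_le _ _).trans (add_le_add ((abs_add_le _ _).trans (add_le_add ?_ ?_)) ?_)) ?_))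
        ?_) <;> rw [abs_mul] <;> refine mul_le_mul_of_nonneg_left ?_ (abs_nonneg _) <;>
        refine (abs_sub _ _).trans ?_
      · linarith
      · rw [abs_mul, abs_mul]
        gcongr
      · linarith
      · linarith
      · linarith
    · rw [uIoc_of_le hL.le] at hx
      have hx' := hl x (Ioc_subset_Icc_self hx)
      have : Tendsto (fun n => stepRhs a b c L M N p (y n) x) atTop (nhds (h x)) :=
        ((((tendsto_const_nhds.add (hx'.const_mul a)).add ((hx'.const_mul b).mul hκ)).sub
          (hκ.const_mul c)).sub (hx'.const_mul M)).add (hκ.const_mul N)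
      have := (this.sub_const (h x)).abs
      simpa using this
  have hest : ∀ n, ∀ x ∈ Icc 0 L, |y (n + 1) x - z x| ≤ R * J n ∧
      |D L 2 (y (n + 1)) x - D L 2 z x| ≤ R * J n := fun n x hx => by
    have h1 := hR _ ((hy (n + 1)).sub hL hz) ((hys n).2.1.sub hL (hy (n + 1)) hz hbz) x hx
    have h2 : ∫ t in (0 : ℝ)..L, |linOp M N L (fun t => y (n + 1) t - z t) t| = J n := by
      refine integral_congr_ae_Ioo hL.le ?_
      filter_upwards [linOp_sub (M := M) (N := N) hL (hy (n + 1)) hz, (hys n).2.2, hze]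
        with t h1 h2 h3
      rw [h1, h2, h3, stepRhs]
    rw [h2, (hy (n + 1)).D_sub hL hz (by norm_num) hx] at h1
    exact h1
  have hRJ : Tendsto (fun n => R * J n) atTop (nhds 0) := by simpa using hJlim.const_mul R
  have hDz : ∀ x ∈ Icc 0 L, Tendsto (fun n => D L 2 (y n) x) atTop (nhds (D L 2 z x)) :=
    fun x hx => by
      rw [← tendsto_add_atTop_iff_nat 1, tendsto_iff_dist_tendsto_zero]
      exact squeeze_zero (fun _ => dist_nonneg) (fun n => (hest n x hx).2) hRJ
  have hIz : Tendsto (fun n => ∫ t in (0 : ℝ)..L, y n t) atTop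
      (nhds (∫ t in (0 : ℝ)..L, z t)) := by
    rw [← tendsto_add_atTop_iff_nat 1, tendsto_iff_dist_tendsto_zero]
    refine squeeze_zero (fun _ => dist_nonneg)
      (fun n => dist_integral_le hL (hy (n + 1)) hz fun x hx => (hest n x hx).1) ?_
    simpa using hRJ.mul_const L
  -- Uniqueness of limits identifies `κ` with `∫ z` and `l` with `z''`, turning the linear equation
  -- for `z` into the Melan equation.
  have hκz : κ = ∫ t in (0 : ℝ)..L, z t := tendsto_nhds_unique hκ hIz
  have hlz : ∀ x ∈ Icc 0 L, l x = D L 2 z x := fun x hx =>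
    tendsto_nhds_unique (hl x hx) (hDz x hx)
  refine ⟨z, ⟨hz, hbz, ?_⟩, ?_, hDz⟩
  · filter_upwards [hze, ae_restrict_mem measurableSet_Ioo] with x hx hx'
    rw [linOp_eq_melanOp a b c L M N p z] at hx
    simp only [stepRhs, rhs, hh] at hx
    rw [hlz x (Ioo_subset_Icc_self hx'), hκz] at hx
    linarith
  · rw [Metric.tendstoUniformlyOn_iff]
    intro ε hε
    obtain ⟨n₀, hn₀⟩ := eventually_atTop.1 (hRJ.eventually_lt_const hε)
    -- The estimate at index `n` controls `y (n + 1)`, hence the shift by one.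
    filter_upwards [eventually_ge_atTop (n₀ + 1)] with n hn x hx
    obtain ⟨k, rfl⟩ := Nat.exists_eq_add_of_le' (Nat.one_le_of_lt hn)
    rw [dist_comm]
    exact ((hest k x hx).1).trans_lt (hn₀ k (by omega))

/-! ### The two sequences and the extremal solutions -/

theorem exists_tendsto_of_antitone {f : ℕ → ℝ} (hf : Antitone f) {B : ℝ} (hB : ∀ n, B ≤ f n) :
    ∃ l, Tendsto f atTop (nhds l) :=
  ⟨_, tendsto_atTop_ciInf hf ⟨B, by rintro _ ⟨n, rfl⟩; exact hB n⟩⟩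

theorem exists_tendsto_of_monotone {f : ℕ → ℝ} (hf : Monotone f) {B : ℝ} (hB : ∀ n, f n ≤ B) :
    ∃ l, Tendsto f atTop (nhds l) :=
  ⟨_, tendsto_atTop_ciSup hf ⟨B, by rintro _ ⟨n, rfl⟩; exact hB n⟩⟩

theorem below_of_tendsto {L : ℝ} {u v : ℕ → ℝ → ℝ} {u' v' : ℝ → ℝ}
    (hu : ∀ x ∈ Icc 0 L, Tendsto (fun n => u n x) atTop (nhds (u' x)))
    (hu₂ : ∀ x ∈ Icc 0 L, Tendsto (fun n => D L 2 (u n) x) atTop (nhds (D L 2 u' x)))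
    (hv : ∀ x ∈ Icc 0 L, Tendsto (fun n => v n x) atTop (nhds (v' x)))
    (hv₂ : ∀ x ∈ Icc 0 L, Tendsto (fun n => D L 2 (v n) x) atTop (nhds (D L 2 v' x)))
    (h : ∀ n, Below L (u n) (v n)) : Below L u' v' := fun x hx =>
  ⟨le_of_tendsto_of_tendsto' (hu x hx) (hv x hx) fun n => (h n x hx).1,
    le_of_tendsto_of_tendsto' (hv₂ x hx) (hu₂ x hx) fun n => (h n x hx).2⟩

namespace MonotoneSetting

variable {a b c L M N : ℝ} {p β : ℝ → ℝ}

/-- The monotone iterative method between a lower solution `α` and an upper solution `β`. -/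
theorem monotone_method (S : MonotoneSetting a b c L M N p β) {α : ℝ → ℝ}
    (hα : IsLowerSolution a b c L p α) (hβ : IsUpperSolution a b c L p β) (hαβ : Below L α β) :
    ∃ (αs βs : ℕ → ℝ → ℝ) (yMin yMax : ℝ → ℝ),
      IsTheIteration a b c L M N p α αs ∧
      IsTheIteration a b c L M N p β βs ∧
      (∀ n, Below L (αs n) (αs (n + 1)) ∧ Below L (αs n) (βs n) ∧
        Below L (βs (n + 1)) (βs n)) ∧
      IsMinSolution a b c L p α β yMin ∧
      IsMaxSolution a b c L p α β yMax ∧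
      TendstoUniformlyOn αs yMin atTop (Icc 0 L) ∧
      TendstoUniformlyOn βs yMax atTop (Icc 0 L) := by
  have hL := S.hL
  obtain ⟨αs, hα0, hαm, hαi⟩ := S.exists_iteration hα.1
  obtain ⟨βs, hβ0, hβm, hβi⟩ := S.exists_iteration hβ.1
  have hαs := hαi.1.2
  have hβs := hβi.1.2
  -- Both parts are proved together, because monotonicity of a step is available only below `β`.
  have hββ : ∀ n, Below L (βs (n + 1)) (βs n) ∧ Below L (βs n) β := fun n => by
    induction n with
    | zero =>
      have h := hβs 0
      rw [hβ0] at h ⊢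
      exact ⟨S.step_below_of_upper hβ h, Below.refl L β⟩
    | succ n ih =>
      have h := ih.1.trans ih.2
      exact ⟨S.step_mono (hβm (n + 1)) (hβm n) ih.1 ih.2 (hβs (n + 1)) (hβs n), h⟩
  have hαβn : ∀ n, Below L (αs n) (βs n) :=
    S.below_iteration hαm hβm hαs hβs (by rwa [hα0, hβ0]) fun n => (hββ n).2
  have hαβ' : ∀ n, Below L (αs n) β := fun n => (hαβn n).trans (hββ n).2
  have hαα : ∀ n, Below L (αs n) (αs (n + 1)) :=
    S.below_iteration hαm (fun n => hαm (n + 1)) hαs (fun n => hαs (n + 1))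
      (by have h := hαs 0; rw [hα0] at h ⊢; exact S.below_step_of_lower hα h)
      fun n => hαβ' (n + 1)
  have hααn : ∀ n, Below L α (αs n) := fun n => by
    induction n with
    | zero => rw [hα0]; exact Below.refl L α
    | succ n ih => exact ih.trans (hαα n)
  have hαβs : ∀ n, Below L α (βs n) := fun n => (hααn n).trans (hαβn n)
  -- In the sector `u''` lies between the continuous functions `β''` and `α''`, which gives one
  -- bound for all iterates.
  obtain ⟨B, hB⟩ : ∃ B, ∀ u, Below L α u → Below L u β → ∀ x ∈ Icc 0 L, |D L 2 u x| ≤ B := by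
    obtain ⟨B₁, h₁⟩ := isCompact_Icc.exists_bound_of_continuousOn
      (hα.1.continuousOn hL (k := 2) (by norm_num))
    obtain ⟨B₂, h₂⟩ := isCompact_Icc.exists_bound_of_continuousOn
      (hβ.1.continuousOn hL (k := 2) (by norm_num))
    refine ⟨max B₁ B₂, fun u hu hu' x hx => abs_le.2 ⟨?_, ?_⟩⟩
    · have := (abs_le.1 (h₂ x hx)).1
      linarith [(hu' x hx).2, le_max_right B₁ B₂]
    · have := (abs_le.1 (h₁ x hx)).2
      linarith [(hu x hx).2, le_max_left B₁ B₂]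
  obtain ⟨y, hy, hyu, hyd⟩ := iteration_converges hL S.hM S.hN S.hp hαm hαs
    (fun n => hB _ (hααn n) (hαβ' n))
    (fun x hx => exists_tendsto_of_antitone (antitone_nat_of_succ_le fun n => (hαα n x hx).2)
      fun n => (hαβ' n x hx).2)
    (exists_tendsto_of_monotone
      (monotone_nat_of_le_succ fun n => (hαα n).integral_le hL (hαm n) (hαm (n + 1)))
      fun n => (hαβ' n).integral_le hL (hαm n) hβ.1)
  obtain ⟨z, hz, hzu, hzd⟩ := iteration_converges hL S.hM S.hN S.hp hβm hβs
    (fun n => hB _ (hαβs n) (hββ n).2)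
    (fun x hx => exists_tendsto_of_monotone (monotone_nat_of_le_succ fun n => ((hββ n).1 x hx).2)
      fun n => (hαβs n x hx).2)
    (exists_tendsto_of_antitone
      (antitone_nat_of_succ_le fun n => (hββ n).1.integral_le hL (hβm (n + 1)) (hβm n))
      fun n => (hαβs n).integral_le hL hα.1 (hβm n))
  have hyt : ∀ x ∈ Icc 0 L, Tendsto (fun n => αs n x) atTop (nhds (y x)) :=
    fun x hx => hyu.tendsto_at hx
  have hzt : ∀ x ∈ Icc 0 L, Tendsto (fun n => βs n x) atTop (nhds (z x)) :=
    fun x hx => hzu.tendsto_at hx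
  have below_y : ∀ {u}, (∀ n, Below L (αs n) u) → Below L y u := fun {u} h =>
    below_of_tendsto hyt hyd (v := fun _ => u) (fun _ _ => tendsto_const_nhds)
      (fun _ _ => tendsto_const_nhds) h
  have y_above : ∀ {u}, (∀ n, Below L u (αs n)) → Below L u y := fun {u} h =>
    below_of_tendsto (u := fun _ => u) (fun _ _ => tendsto_const_nhds)
      (fun _ _ => tendsto_const_nhds) hyt hyd h
  have below_z : ∀ {u}, (∀ n, Below L (βs n) u) → Below L z u := fun {u} h =>
    below_of_tendsto hzt hzd (v := fun _ => u) (fun _ _ => tendsto_const_nhds)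
      (fun _ _ => tendsto_const_nhds) h
  have z_above : ∀ {u}, (∀ n, Below L u (βs n)) → Below L u z := fun {u} h =>
    below_of_tendsto (u := fun _ => u) (fun _ _ => tendsto_const_nhds)
      (fun _ _ => tendsto_const_nhds) hzt hzd h
  refine ⟨αs, βs, y, z, hαi, hβi, fun n => ⟨hαα n, hαβn n, (hββ n).1⟩,
    ⟨hy, ⟨hy.1.1.of_le (by norm_num), y_above hααn, below_y hαβ'⟩, fun u hu hus => below_y ?_⟩,
    ⟨hz, ⟨hz.1.1.of_le (by norm_num), z_above hαβs, below_z fun n => (hββ n).2⟩,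
      fun u hu hus => z_above ?_⟩, hyu, hzu⟩
  · exact S.below_iteration hαm (fun _ => hu.1) hαs (fun _ => isStep_self_of_isSolution hu)
      (by rw [hα0]; exact hus.2.1) fun _ => hus.2.2
  · exact S.below_iteration (fun _ => hu.1) hβm (fun _ => isStep_self_of_isSolution hu) hβs
      (by rw [hβ0]; exact hus.2.2) fun n => (hββ n).2

end MonotoneSetting

/-! ### The sine function as an upper solution -/

theorem hasDerivAt_sin_mul (r k x : ℝ) :
    HasDerivAt (fun t => r * Real.sin (k * t)) (r * k * Real.cos (k * x)) x :=
  ((((hasDerivAt_id x).const_mul k).sin).const_mul r).congr_deriv (by simp; ring)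

theorem hasDerivAt_cos_mul (r k x : ℝ) :
    HasDerivAt (fun t => r * Real.cos (k * t)) (-(r * k) * Real.sin (k * x)) x :=
  ((((hasDerivAt_id x).const_mul k).cos).const_mul r).congr_deriv (by simp; ring)

theorem memW41_sin {L : ℝ} (hL : 0 < L) (r k : ℝ) :
    MemW41 L (fun x => r * Real.sin (k * x)) ∧
      (∀ x ∈ Icc 0 L, D L 2 (fun x => r * Real.sin (k * x)) x
        = -(r * k ^ 2) * Real.sin (k * x)) ∧
      ∀ x ∈ Ioo 0 L, D L 4 (fun x => r * Real.sin (k * x)) x = r * k ^ 4 * Real.sin (k * x) := by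
  obtain ⟨h1, h2, h3⟩ := memW41_of_hasDerivAt hL (hasDerivAt_sin_mul r k)
    (hasDerivAt_cos_mul (r * k) k) (hasDerivAt_sin_mul (-(r * k * k)) k)
    (ContDiffOn.absolutelyContinuousOnInterval (ContDiff.contDiffOn (by fun_prop)))
  refine ⟨h1, fun x hx => ?_, fun x hx => ?_⟩
  · rw [h2 x hx]; ring
  · rw [h3 x hx, (hasDerivAt_cos_mul _ k x).deriv]; ring

theorem integral_sin_pi_div {L : ℝ} (hL : 0 < L) (r : ℝ) :
    ∫ x in (0 : ℝ)..L, r * Real.sin (Real.pi / L * x) = 2 * r * L / Real.pi := by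
  have hk : Real.pi / L ≠ 0 := (div_pos Real.pi_pos hL).ne'
  have hL' := hL.ne'
  rw [intervalIntegral.integral_const_mul,
    intervalIntegral.integral_comp_mul_left (fun t => Real.sin t) hk, integral_sin,
    div_mul_cancel₀ _ hL']
  simp only [mul_zero, Real.cos_zero, Real.cos_pi, smul_eq_mul]
  field_simp
  ring

end Melan

theorem theorem5p1 (L a b c lam M N : ℝ) (p β : ℝ → ℝ)
    (hL : 0 < L) (ha : 0 < a) (hb : 0 < b) (hc : 0 < c) (hlam : 0 < lam)
    (hp : IntegrableOn p (Icc 0 L))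
    (hp0 : ∀ᵐ x ∂volume.restrict (Ioo 0 L), 0 ≤ p x)
    (hp1 : ∀ᵐ x ∂volume.restrict (Ioo 0 L),
      p x ≤ (lam * Real.pi ^ 4 / L ^ 4 + a * lam * Real.pi ^ 2 / L ^ 2
          + 2 * b * lam ^ 2 * Real.pi / L) * Real.sin (Real.pi / L * x)
        + 2 * lam * c * L / Real.pi)
    (hβ : β = fun x => lam * Real.sin (Real.pi / L * x))
    (hM : M = a + 2 * b * lam * L / Real.pi)
    (hN : N = c + b * lam * Real.pi ^ 2 / L ^ 2)
    (hMN : N ≤ 4 * M / L ^ 3 * Melan.sigma (Real.sqrt M * L)) :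
    Melan.IsLowerSolution a b c L p (fun _ => 0) ∧
    Melan.IsUpperSolution a b c L p β ∧
    M = a + b * (∫ x in (0 : ℝ)..L, β x) ∧
    (∃ m, IsLeast (Melan.D L 2 β '' Icc 0 L) m ∧ N = c - b * m) ∧
    ∃ (αs βs : ℕ → ℝ → ℝ) (yMin yMax : ℝ → ℝ),
      Melan.IsTheIteration a b c L M N p (fun _ => 0) αs ∧
      Melan.IsTheIteration a b c L M N p β βs ∧
      (∀ n, Melan.Below L (αs n) (αs (n + 1)) ∧ Melan.Below L (αs n) (βs n) ∧
        Melan.Below L (βs (n + 1)) (βs n)) ∧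
      Melan.IsMinSolution a b c L p (fun _ => 0) β yMin ∧
      Melan.IsMaxSolution a b c L p (fun _ => 0) β yMax ∧
      TendstoUniformlyOn αs yMin atTop (Icc 0 L) ∧
      TendstoUniformlyOn βs yMax atTop (Icc 0 L) := by
  have hπ := Real.pi_pos
  have hL' := hL.ne'
  have hπ' := hπ.ne'
  -- The zero function, viewed as a sine with amplitude and frequency zero.
  obtain ⟨mem0, D2zero, D4zero⟩ := Melan.memW41_sin hL 0 0
  obtain ⟨memβ, D2β, D4β⟩ := Melan.memW41_sin hL lam (Real.pi / L)
  have intβ := Melan.integral_sin_pi_div hL lam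
  rw [← hβ] at memβ D2β D4β
  have intβ' : ∫ x in (0 : ℝ)..L, β x = 2 * lam * L / Real.pi := by rw [hβ, intβ]
  simp only [zero_mul, neg_zero] at mem0 D2zero D4zero
  have hsin : ∀ x ∈ Icc 0 L, 0 ≤ Real.sin (Real.pi / L * x) := fun x hx => by
    refine Real.sin_nonneg_of_nonneg_of_le_pi (mul_nonneg (by positivity) hx.1) ?_
    calc Real.pi / L * x ≤ Real.pi / L * L := by gcongr; exact hx.2
      _ = Real.pi := div_mul_cancel₀ _ hL'
  have hlower : Melan.IsLowerSolution a b c L p (fun _ => 0) := by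
    refine ⟨mem0, ⟨rfl, rfl, D2zero 0 (left_mem_Icc.2 hL.le), D2zero L (right_mem_Icc.2 hL.le)⟩, ?_⟩
    filter_upwards [hp0, ae_restrict_mem measurableSet_Ioo] with x hx hx'
    simpa [Melan.melanOp, D2zero x (Ioo_subset_Icc_self hx'), D4zero x hx'] using hx
  have hupper : Melan.IsUpperSolution a b c L p β := by
    refine ⟨memβ, ⟨by simp [hβ], by simp [hβ, div_mul_cancel₀ _ hL'], ?_, ?_⟩, ?_⟩
    · simp [D2β 0 (left_mem_Icc.2 hL.le)]
    · simp [D2β L (right_mem_Icc.2 hL.le), div_mul_cancel₀ _ hL']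
    · filter_upwards [hp1, ae_restrict_mem measurableSet_Ioo] with x hx hx'
      rw [Melan.melanOp, D2β x (Ioo_subset_Icc_self hx'), D4β x hx', intβ']
      -- The bound assumed on `p` equals the Melan operator applied to `β`, so what is left is an
      -- identity.
      refine hx.trans_eq ?_
      field_simp
      ring
  have hMβ : M = a + b * ∫ x in (0 : ℝ)..L, β x := by rw [intβ', hM]; ring
  have hleast : ∀ x ∈ Icc 0 L, -(lam * (Real.pi / L) ^ 2) ≤ Melan.D L 2 β x := fun x hx => by
    rw [D2β x hx]
    have h1 := Real.sin_le_one (Real.pi / L * x)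
    have h2 : 0 ≤ lam * (Real.pi / L) ^ 2 := by positivity
    nlinarith
  have hNm : N = c - b * -(lam * (Real.pi / L) ^ 2) := by rw [hN]; field_simp; ring
  -- The minimum of `β''` is attained at the midpoint, where the sine equals `1`.
  refine ⟨hlower, hupper, hMβ, ⟨-(lam * (Real.pi / L) ^ 2), ⟨⟨L / 2, ?_, ?_⟩, ?_⟩, hNm⟩, ?_⟩
  · constructor <;> linarith
  · rw [D2β _ (by constructor <;> linarith)]
    have : Real.pi / L * (L / 2) = Real.pi / 2 := by field_simp
    rw [this, Real.sin_pi_div_two, mul_one]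
  · rintro _ ⟨x, hx, rfl⟩
    exact hleast x hx
  · have S : Melan.MonotoneSetting a b c L M N p β :=
      { hL := hL
        hb := hb
        hM := by rw [hM]; positivity
        hN := by rw [hN]; positivity
        hσ := hMN
        hp := hp
        memβ := memβ
        M_eq := hMβ
        N_ge := fun x hx => by
          rw [hNm]
          nlinarith [mul_le_mul_of_nonneg_left (hleast x hx) hb.le] }
    refine S.monotone_method hlower hupper fun x hx => ⟨?_, ?_⟩
    · rw [hβ]
      exact mul_nonneg hlam.le (hsin x hx)
    · rw [D2zero x hx, D2β x hx, neg_mul]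
      exact neg_nonpos.2 (mul_nonneg (by positivity) (hsin x hx))
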